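/- **Theorem (Reduction of the logarithmic penalty via neural approximation).** Let $\gamma\in(0,1]$, $\mathbb T=\mathbb R/2\pi\mathbb Z$, $\|u\|_{H^\gamma}^2=\sum_{k\in\mathbb Z}(1+k^2)^{\gamma}|\hat u_k|^2$, and let $L^2(\mathbb T)$ carry the measure $dx/2\pi$ (functions are complex-valued). *Neural correctors.* A neural corrector consists of $M\in\mathbb N$, an $L^2$-orthonormal family $\Phi=(\phi_1,\dots,\phi_M)$ and a fully connected feed-forward network $\mathcal G_\theta:\mathbb C^M\times\mathbb R\to\mathbb C^M$ (any depth and widths, real weights acting on real and imaginary parts, affine output layer) with activation $\sigma$ applied componentwise in the hidden layers. It defines $\mathcal H_{neural}(u,\tau;\theta)=\sum_{j}\mathcal G_\theta\big((\langle\phi_i,u\rangle_{L^2})_{i},\tau\big)_j\,\phi_j$. Below, $\sigma:\mathbb R\to\mathbb R$ is an arbitrary Lipschitz function that is not a polynomial. *Defect.* For $k=k_1+k_2+k_3$ put $\phi_1=k^3-k_1^3-(k_2+k_3)^3$, $\phi_2=(k_2+k_3)^3-k_2^3-k_3^3$, $\phi=\phi_1+\phi_2=k^3-k_1^3-k_2^3-k_3^3$,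 and $\mathcal M_\tau(f)=\frac1\tau\int_0^\tau f(s)\,ds$. For $t_n\in\mathbb R$, $\tau>0$ let $\mathcal I_{exact}(u,\tau)$ and $\mathcal I_{LRI}(u,\tau)$ be the functions of zero mean whose Fourier coefficients at $k\neq0$ are $$-e^{i(t_n+\tau)k^3}\sum_{k_1+k_2+k_3=k}\frac{1}{18ik}\,e^{-it_n\phi}\,\kappa\;\hat u_{k_1}\hat u_{k_2}\hat u_{k_3}$$ with $\kappa=\int_0^\tau e^{-is(\phi_1+\phi_2)}ds$ for $\mathcal I_{exact}$ and $\kappa=\tau\,\mathcal M_\tau(e^{-is\phi_1})\mathcal M_\tau(e^{-is\phi_2})$ for $\mathcal I_{LRI}$; these are the cubic interaction of the KdV equation $\partial_tu+\partial_x^3u=\frac12\partial_x(u^2)$ over $[t_n,t_n+\tau]$ and its evaluation by the unfiltered low-regularity integrator. Put $\mathcal E_{defect}(u)=\mathcal I_{exact}(u,\tau)-\mathcal I_{LRI}(u,\tau)$. 1. (General defects.) Let $\mathcal K\subset H^\gamma(\mathbb T)$ be compact, $\tau>0$, and let $\mathcal E:\mathcal K\to L^2(\mathbb T)$ be continuous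 for the $H^\gamma$ topology with $\mathcal E(u)\ne0$ for all $u\in\mathcal K$. For every $\varepsilon_{net}>0$ there is a neural corrector with $$\frac{\|\mathcal E(u)-\mathcal H_{neural}(u,\tau;\theta)\|_{L^2}}{\|\mathcal E(u)\|_{L^2}}\le\varepsilon_{net}\qquad\text{for all }u\in\mathcal K ,$$ and for every $C$ such that $\|\mathcal E(u)\|_{L^2}\le C\tau^{1+\gamma}\ln(1/\tau)\|u\|_{H^\gamma}^3$ on $\mathcal K$ it satisfies $\|\mathcal E(u)-\mathcal H_{neural}(u,\tau;\theta)\|_{L^2}\le C\varepsilon_{net}\tau^{1+\gamma}\ln(1/\tau)\|u\|_{H^\gamma}^3$ on $\mathcal K$. 2. (The defect of the unfiltered integrator.) For every $\tau_0\in(0,1)$ there is a constant $C>0$, depending only on $\gamma$ and $\tau_0$, such that for all $t_n\in\mathbb R$ and $\tau\in(0,\tau_0]$: * for all $u\in H^\gamma(\mathbb T)$, $\mathcal E_{defect}(u)\in L^2(\mathbb T)$ has the Fourier coefficients given by the displayed, absolutely convergent, sum with $\kappa=\tau\,\boldsymbol\eta$, where $\boldsymbol\eta=\mathcal M_\tau(e^{-is(\phi_1+\phi_2)})-\mathcal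 M_\tau(e^{-is\phi_1})\mathcal M_\tau(e^{-is\phi_2})$; moreover $\mathcal E_{defect}:H^\gamma(\mathbb T)\to L^2(\mathbb T)$ is continuous, and $\|\mathcal E_{defect}(u)\|_{L^2}\le C\tau^{1+\gamma}\ln(1/\tau)\|u\|_{H^\gamma}^3$; * for every compact $\mathcal K\subset\{u\in H^\gamma(\mathbb T):\|u\|_{H^\gamma}\le R\}$, $R>0$, and every $\varepsilon_{net}>0$ there is a neural corrector for which the local truncation error $\mathrm{LTE}_{HIN}(u)=\mathcal E_{defect}(u)-\mathcal H_{neural}(u,\tau;\theta)$ satisfies $$\sup_{u\in\mathcal K}\|\mathrm{LTE}_{HIN}(u)\|_{L^2}\le C R^3\,\varepsilon_{net}\,\tau^{1+\gamma}\ln(1/\tau),$$ and which, if $\mathcal E_{defect}$ has no zero in $\mathcal K$, also satisfies $\|\mathrm{LTE}_{HIN}(u)\|_{L^2}\le\varepsilon_{net}\|\mathcal E_{defect}(u)\|_{L^2}$ for all $u\in\mathcal K$. -/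

import Mathlib

open Complex MeasureTheory
open scoped ENNReal

noncomputable section

namespace HINLRI

/-! ### The torus, `L²` and the Sobolev spaces -/

instance instFactTwoPiPos : Fact (0 < 2 * Real.pi) := ⟨Real.two_pi_pos⟩

/-- The torus `𝕋 = ℝ / 2πℤ`. -/
abbrev Torus : Type := AddCircle (2 * Real.pi)

/-- The complex Hilbert space `L²(𝕋)` (normalised Haar measure `dx / 2π`). -/
abbrev L2 : Type := Lp ℂ 2 (AddCircle.haarAddCircle (T := 2 * Real.pi))

/-- The Fourier coefficient `f̂(k) = (2π)⁻¹ ∫ f(x) e^{-ikx} dx`. -/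
def coeff (f : L2) (k : ℤ) : ℂ := fourierCoeff (f : Torus → ℂ) k

theorem coeff_eq_repr (f : L2) (k : ℤ) : coeff f k = fourierBasis.repr f k :=
  (fourierBasis_repr f k).symm

/-- The function in `L²(𝕋)` with prescribed square-summable Fourier coefficients
(and `0` if the prescribed sequence is not square-summable). -/
def ofCoeff (a : ℤ → ℂ) : L2 :=
  open Classical in
  if h : Memℓp a 2 then fourierBasis.repr.symm (⟨a, h⟩ : lp (fun _ : ℤ => ℂ) 2) else 0

/-- The weight `⟨k⟩ ^ γ = (1 + k²) ^ (γ / 2)`. -/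
def weight (γ : ℝ) (k : ℤ) : ℝ := (1 + (k : ℝ) ^ 2) ^ (γ / 2)

theorem weight_pos (γ : ℝ) (k : ℤ) : 0 < weight γ k :=
  Real.rpow_pos_of_pos (by positivity) _

/-- The functions `f ∈ L²(𝕋)` with `∑ ⟨k⟩^{2γ} |f̂(k)|² < ∞`. -/
def sobolevSubmodule (γ : ℝ) : Submodule ℂ L2 where
  carrier := {f | Memℓp (fun k : ℤ => (weight γ k : ℂ) * coeff f k) 2}
  zero_mem' := by
    have : (fun k : ℤ => (weight γ k : ℂ) * coeff 0 k) = 0 := by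
      ext k; simp [coeff_eq_repr]
    simp only [Set.mem_ofPred_eq, this]
    exact zero_memℓp
  add_mem' := by
    intro f g hf hg
    have : (fun k : ℤ => (weight γ k : ℂ) * coeff (f + g) k)
        = (fun k : ℤ => (weight γ k : ℂ) * coeff f k)
          + (fun k : ℤ => (weight γ k : ℂ) * coeff g k) := by
      ext k; simp [coeff_eq_repr, mul_add]
    simp only [Set.mem_ofPred_eq, this] at *
    exact hf.add hg
  smul_mem' := by
    intro c f hf
    have : (fun k : ℤ => (weight γ k : ℂ) * coeff (c • f) k)
        = c • (fun k : ℤ => (weight γ k : ℂ) * coeff f k) := by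
      ext k; simp only [coeff_eq_repr, map_smul, lp.coeFn_smul, Pi.smul_apply, smul_eq_mul]; ring
    simp only [Set.mem_ofPred_eq, this] at *
    exact hf.const_smul c

/-- The Sobolev space `H^γ(𝕋)` (for `γ ≥ 0`), with the norm
`‖u‖_{H^γ} = (∑ ⟨k⟩^{2γ} |û(k)|²)^{1/2}` and the topology of that norm. -/
def Sobolev (γ : ℝ) : Type := sobolevSubmodule γ

instance (γ : ℝ) : AddCommGroup (Sobolev γ) := inferInstanceAs (AddCommGroup (sobolevSubmodule γ))

instance (γ : ℝ) : Module ℂ (Sobolev γ) := inferInstanceAs (Module ℂ (sobolevSubmodule γ))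

/-- The inclusion `H^γ(𝕋) ⊆ L²(𝕋)`. -/
def Sobolev.toL2 {γ : ℝ} : Sobolev γ →ₗ[ℂ] L2 := (sobolevSubmodule γ).subtype

/-- The weighted Fourier coefficients `k ↦ ⟨k⟩^γ û(k)`, an element of `ℓ²(ℤ)`. -/
def Sobolev.weighted {γ : ℝ} : Sobolev γ →ₗ[ℂ] lp (fun _ : ℤ => ℂ) 2 where
  toFun u := ⟨fun k : ℤ => (weight γ k : ℂ) * coeff (Sobolev.toL2 u) k, u.2⟩
  map_add' u v := by
    ext k
    simp only [map_add, coeff_eq_repr, lp.coeFn_add, Pi.add_apply]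
    ring
  map_smul' c u := by
    ext k
    simp only [map_smul, coeff_eq_repr, lp.coeFn_smul, Pi.smul_apply, smul_eq_mul,
      RingHom.id_apply]
    ring

theorem Sobolev.weighted_injective {γ : ℝ} :
    Function.Injective (Sobolev.weighted : Sobolev γ →ₗ[ℂ] lp (fun _ : ℤ => ℂ) 2) := by
  intro u v h
  have h2 : Sobolev.toL2 u = Sobolev.toL2 v := by
    apply (fourierBasis (T := 2 * Real.pi)).repr.injective
    ext k
    have hk : (weight γ k : ℂ) * coeff (Sobolev.toL2 u) k
        = (weight γ k : ℂ) * coeff (Sobolev.toL2 v) k :=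
      congrFun (congrArg Subtype.val h) k
    have hw : (weight γ k : ℂ) ≠ 0 := by exact_mod_cast (weight_pos γ k).ne'
    simpa [coeff_eq_repr] using mul_left_cancel₀ hw hk
  exact Subtype.ext h2

instance (γ : ℝ) : NormedAddCommGroup (Sobolev γ) :=
  NormedAddCommGroup.induced (Sobolev γ) (lp (fun _ : ℤ => ℂ) 2) Sobolev.weighted
    Sobolev.weighted_injective

instance (γ : ℝ) : NormedSpace ℂ (Sobolev γ) :=
  NormedSpace.induced ℂ (Sobolev γ) (lp (fun _ : ℤ => ℂ) 2) Sobolev.weighted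

/-- The Fourier coefficients of `u ∈ H^γ(𝕋)`. -/
def Sobolev.hat {γ : ℝ} (u : Sobolev γ) (k : ℤ) : ℂ := coeff (Sobolev.toL2 u) k

/-! ### The resonance defect of the unfiltered low-regularity integrator for KdV

For `∂ₜu + ∂ₓ³u = ½ ∂ₓ(u²)` the linear propagator `U_L(t) = e^{-t∂ₓ³}` is multiplication by
`e^{itk³}` on the Fourier side. The cubic interaction `(k₁, k₂, k₃) ↦ k = k₁ + k₂ + k₃` has the
resonance phase `φ = k³ - k₁³ - k₂³ - k₃³ = φ₁ + φ₂`, split along the two nested quadratic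
interactions `(k₁, k₂ + k₃) ↦ k` and `(k₂, k₃) ↦ k₂ + k₃`. -/

/-- The phase `φ₁ = k³ - k₁³ - (k₂ + k₃)³` of the outer interaction, `k = k₁ + k₂ + k₃`. -/
def phaseOuter (k₁ k₂ k₃ : ℤ) : ℝ :=
  (k₁ + k₂ + k₃ : ℝ) ^ 3 - (k₁ : ℝ) ^ 3 - (k₂ + k₃ : ℝ) ^ 3

/-- The phase `φ₂ = (k₂ + k₃)³ - k₂³ - k₃³` of the inner interaction. -/
def phaseInner (k₂ k₃ : ℤ) : ℝ :=
  (k₂ + k₃ : ℝ) ^ 3 - (k₂ : ℝ) ^ 3 - (k₃ : ℝ) ^ 3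

/-- The full cubic resonance phase `φ = k³ - k₁³ - k₂³ - k₃³`, `k = k₁ + k₂ + k₃`. -/
def phase (k₁ k₂ k₃ : ℤ) : ℝ :=
  (k₁ + k₂ + k₃ : ℝ) ^ 3 - (k₁ : ℝ) ^ 3 - (k₂ : ℝ) ^ 3 - (k₃ : ℝ) ^ 3

theorem phase_eq_add (k₁ k₂ k₃ : ℤ) :
    phase k₁ k₂ k₃ = phaseOuter k₁ k₂ k₃ + phaseInner k₂ k₃ := by
  simp only [phase, phaseOuter, phaseInner]; ring

/-- The interval average `M_τ(e^{-isφ}) = τ⁻¹ ∫₀^τ e^{-isφ} ds`. -/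
def avg (τ φ : ℝ) : ℂ := (τ : ℂ)⁻¹ * ∫ s in (0 : ℝ)..τ, exp (-(I * s * φ))

/-- The phase mismatch kernel
`η = M_τ(e^{-is(φ₁+φ₂)}) - M_τ(e^{-isφ₁}) M_τ(e^{-isφ₂})`. -/
def mismatch (τ φ₁ φ₂ : ℝ) : ℂ := avg τ (φ₁ + φ₂) - avg τ φ₁ * avg τ φ₂

/-- The summand, at output frequency `k` and input frequencies `k₁, k₂, k₃ = k - k₁ - k₂`, of the
cubic interaction over `[tₙ, tₙ + τ]` in which the time integral of the oscillation is replaced by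
`κ φ₁ φ₂`:
`-e^{i(tₙ+τ)k³} (18ik)⁻¹ e^{-itₙφ} κ(φ₁, φ₂) a(k₁) a(k₂) a(k₃)`.
It vanishes for `k = 0` (projection onto mean-zero functions). -/
def cubicTerm (κ : ℝ → ℝ → ℂ) (tn τ : ℝ) (a : ℤ → ℂ) (k : ℤ) (p : ℤ × ℤ) : ℂ :=
  -exp (I * (tn + τ) * (k : ℂ) ^ 3) *
    ((18 * I * (k : ℂ))⁻¹ * exp (-(I * tn * phase p.1 p.2 (k - p.1 - p.2))) *
      κ (phaseOuter p.1 p.2 (k - p.1 - p.2)) (phaseInner p.2 (k - p.1 - p.2)) *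
      a p.1 * a p.2 * a (k - p.1 - p.2))

/-- The cubic interaction with the exact oscillatory integral `∫₀^τ e^{-is(φ₁+φ₂)} ds`. -/
def exactIntegral (tn τ : ℝ) (a : ℤ → ℂ) : L2 :=
  ofCoeff fun k => ∑' p : ℤ × ℤ,
    cubicTerm (fun φ₁ φ₂ => ∫ s in (0 : ℝ)..τ, exp (-(I * s * ((φ₁ + φ₂ : ℝ) : ℂ)))) tn τ a k p

/-- The cubic interaction as evaluated by the unfiltered low-regularity integrator, with the
decoupled averages `τ M_τ(e^{-isφ₁}) M_τ(e^{-isφ₂})` in place of the exact integral. -/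
def lriIntegral (tn τ : ℝ) (a : ℤ → ℂ) : L2 :=
  ofCoeff fun k => ∑' p : ℤ × ℤ,
    cubicTerm (fun φ₁ φ₂ => (τ : ℂ) * (avg τ φ₁ * avg τ φ₂)) tn τ a k p

/-- The defect `E_defect(u) = I_exact(u, τ) - I_LRI(u, τ)` over the step `[tₙ, tₙ + τ]`. -/
def defect {γ : ℝ} (tn τ : ℝ) (u : Sobolev γ) : L2 :=
  exactIntegral tn τ u.hat - lriIntegral tn τ u.hat

/-! ### Neural correctors -/

/-- The parameters of a fully connected feed-forward network with `m` inputs and `n` outputs: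
any number of hidden layers of any widths, followed by an affine output layer. -/
inductive MLP : ℕ → ℕ → Type
  | output {m n : ℕ} (W : Matrix (Fin n) (Fin m) ℝ) (b : Fin n → ℝ) : MLP m n
  | hidden {m h n : ℕ} (W : Matrix (Fin h) (Fin m) ℝ) (b : Fin h → ℝ) (next : MLP h n) : MLP m n

/-- The function realised by a network, the activation `σ` acting componentwise. -/
def MLP.eval (σ : ℝ → ℝ) : {m n : ℕ} → MLP m n → (Fin m → ℝ) → (Fin n → ℝ)
  | _, _, .output W b, x => W.mulVec x + b
  | _, _, .hidden W b next, x => next.eval σ (fun i => σ ((W.mulVec x + b) i))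

/-- A neural corrector: a latent dimension, an orthonormal trunk basis in `L²(𝕋)`, and a latent
network `ℂ^K × ℝ → ℂ^K`, complex numbers being fed in and read off through real and imaginary
parts. -/
structure NeuralCorrector where
  latentDim : ℕ
  trunk : Fin latentDim → L2
  orthonormal : Orthonormal ℂ trunk
  net : MLP (latentDim + latentDim + 1) (latentDim + latentDim)

namespace NeuralCorrector

variable (N : NeuralCorrector)

/-- The restriction `R = Φ*` to the latent space. -/
def restrict (f : L2) : Fin N.latentDim → ℂ := fun j => inner ℂ (N.trunk j) f

/-- The prolongation `P = Φ`. -/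
def prolong (c : Fin N.latentDim → ℂ) : L2 := ∑ j, c j • N.trunk j

/-- The latent operator `G_θ(z, τ)`. -/
def latent (σ : ℝ → ℝ) (τ : ℝ) (z : Fin N.latentDim → ℂ) : Fin N.latentDim → ℂ :=
  let y := N.net.eval σ
    (Fin.append (Fin.append (fun j => (z j).re) (fun j => (z j).im)) (fun _ : Fin 1 => τ))
  fun j => (y (Fin.castAdd N.latentDim j) : ℂ) + (y (Fin.natAdd N.latentDim j) : ℂ) * I

/-- The neural correction `H_neural(f, τ; θ) = P (G_θ (R f, τ))`. -/
def correction (σ : ℝ → ℝ) (τ : ℝ) (f : L2) : L2 := N.prolong (N.latent σ τ (N.restrict f))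

end NeuralCorrector

end HINLRI

end

/-! The analytic core is a pointwise estimate of the mismatch kernel η. Four bounds hold
(`mismatchBound`): η is bounded; it is O(τ|φ₁|) and O(τ|φ₂|), because the decoupling is exact as
soon as one phase vanishes; and it is O(1/(τ|φ|)) by integrating the oscillation. The phases factor
as φ₁ = 3kk₁(k₂+k₃), φ₂ = 3k₂k₃(k₂+k₃) and φ = 3(k₁+k₂)(k₂+k₃)(k₃+k₁). Geometric interpolation
between the four bounds, with exponents depending on which frequencies dominate, gives
(`MismatchBound.le_majorant`) |η| ≲ τ^(γ-δ) |k| ∏|kᵢ|^γ times a sum of products r(a)r(b), where r =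
max(1,|·|)^(-(1+δ)/2), and of indicators of kᵢ+kⱼ = 0. The factor |k| is absorbed by 1/(18ik).

By Cauchy–Schwarz every product r(a)r(b) is the kernel of a trilinear convolution form on ℓ² of norm
at most ∑r², and an indicator has norm at most 1 (`TriBound.majorant`). Hence the defect is a
bounded cubic map from H^γ to L² of size τ^(1+γ-δ) ∑r², where ∑r² ≤ 5/δ. Taking δ proportional to
1/ln(1/τ) turns τ^(-δ) into a constant and 1/δ into the logarithm (`exists_cubicBound_defect`).
Trilinearity gives continuity.

For the correctors, the image of a compact set is compact in L², so finitely many Fourier modes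
suffice uniformly; their coefficients are continuous functions on the compact set. Ridge functions
σ(ℓ+b), with ℓ a real-linear functional of finitely many Fourier coefficients, span a dense subspace
(`dense_span_activation`): mollifying σ and differentiating in the slope produces all powers of ℓ,
these produce exponentials, and exponentials span an algebra to which Stone–Weierstrass applies. A
defect without zeros has norm bounded below on the compact set, so a uniform absolute error becomes
a relative one, and a bound on the defect is then inherited with the factor ε. -/

open Complex MeasureTheory
open scoped ENNReal

noncomputable section

namespace HINLRI

/-! ### Logarithmic form of the pointwise kernel estimate -/

section LogEstimates

variable {A P Q R n s t e g δ c : ℝ}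

/-- In this group `e`, `t`, `A`, `n`, `s` are the logarithms of E, τ, |k|, |k₂+k₃|, |k₁+k₂|; `P`,
`Q`, `R` are those of the inputs, ordered according to the case; `c` is log 20, the slack between
comparable frequencies. Here E ≤ 1 gets weight 1-g and the geometric mean of the outer and inner
bounds weight g; the decay falls on the two smaller inputs. -/
theorem log_bound_of_large_output (hc : 0 ≤ c) (hg : 0 ≤ g) (hδ : 0 ≤ δ) (hγ : g + δ ≤ 1)
    (hP : 0 ≤ P) (hQ : 0 ≤ Q) (hR : 0 ≤ R)
    (he : e ≤ 0) (hxy : 2 * e ≤ 2 * t + A + P + Q + R + 2 * n)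
    (hAP : A ≤ P + c) (hPA : P ≤ A + c) (hQP : Q ≤ P) (hRP : R ≤ P) (hn : n ≤ A + c) :
    e ≤ 10 * c + g * t + A + (g + δ) * (P + Q + R) - (1 + δ) / 2 * (Q + R) := by
  have h1 : (1 - g) * e ≤ 0 := mul_nonpos_of_nonneg_of_nonpos (by linarith) he
  have h2 := mul_le_mul_of_nonneg_left hxy hg
  have h3 := mul_le_mul_of_nonneg_left hn hg
  have h4 := mul_le_mul_of_nonneg_left hAP hg
  have h5 : (1 - g) * (Q + R) ≤ (1 - g) * (2 * (A + c)) :=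
    mul_le_mul_of_nonneg_left (by linarith) (by linarith)
  have h6 : g * c ≤ c := mul_le_of_le_one_left hc (by linarith)
  have h7 := mul_nonneg hg hc
  have h8 : 0 ≤ δ * (2 * P + Q + R) := by positivity
  nlinarith

/-- The weights are 1/2 on the outer bound, g-1/2 on the inner one and 1-g on E ≤ 1. The exponent
1/2 produces |k|^(1/2), which is what remains of the factor |k| once the decay at the output is paid
for. -/
theorem log_bound_of_large_outer_high (hc : 0 ≤ c) (hg : 1 / 2 ≤ g) (hδ : 0 ≤ δ)
    (hγ : g + δ ≤ 1) (hP : 0 ≤ P) (hQ : 0 ≤ Q) (hR : 0 ≤ R) (he : e ≤ 0)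
    (hx : e ≤ t + A + P + n) (hy : e ≤ t + Q + R + n)
    (hAP : A ≤ P) (hPQ : P ≤ Q + c) (hn : n ≤ P + c) :
    e ≤ 10 * c + g * t + A + (g + δ) * (P + Q + R) - (1 + δ) / 2 * (A + R) := by
  have h1 : (1 - g) * e ≤ 0 := mul_nonpos_of_nonneg_of_nonpos (by linarith) he
  have h2 := mul_le_mul_of_nonneg_left hy (by linarith : 0 ≤ g - 1 / 2)
  have h3 := mul_le_mul_of_nonneg_left hn (by linarith : 0 ≤ g)
  have h4 := mul_le_mul_of_nonneg_left hPQ (by linarith : 0 ≤ g)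
  have h6 : g * c ≤ c := mul_le_of_le_one_left hc (by linarith)
  have h8 : 0 ≤ δ * (2 * P + 2 * Q + R - A) := mul_nonneg hδ (by linarith)
  nlinarith

/-- Below g = 1/2 the outer bound with weight 1/2 costs more derivatives than are available. The
reciprocal full phase `hz`, with weight 1/2-g, brings the powers of τ and of the large inputs back
to the right ones. It supplies a negative power of |k₁+k₂| where one of |k₃| is wanted, so the decay
goes to the smaller of the two. -/
theorem log_bound_of_large_outer_low (hc : 0 ≤ c) (hg : 0 ≤ g) (hg' : g ≤ 1 / 2) (hδ : 0 ≤ δ)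
    (hγ : g + δ ≤ 1) (hP : 0 ≤ P) (hQ : 0 ≤ Q) (hR : 0 ≤ R) (he : e ≤ 0)
    (hx : e ≤ t + A + P + n) (hz : e + t + 2 * P - 2 * c + s ≤ 0)
    (hAP : A ≤ P) (hPQ : P ≤ Q + c) (hn : n ≤ P + c) (hs : s ≤ P + c) :
    e ≤ 10 * c + g * t + A + (g + δ) * (P + Q + R) - (1 + δ) / 2 * (A + R) ∨
    e ≤ 10 * c + g * t + A + (g + δ) * (P + Q + R) - (1 + δ) / 2 * (A + s) := by
  have h1 : g * e ≤ 0 := mul_nonpos_of_nonneg_of_nonpos (by linarith) he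
  have h2 := mul_le_mul_of_nonneg_left hz (by linarith : 0 ≤ 1 / 2 - g)
  have h4 := mul_le_mul_of_nonneg_left hPQ (by linarith : 0 ≤ g)
  have h6 : g * c ≤ c := mul_le_of_le_one_left hc (by linarith)
  have h9 := mul_nonneg hg hc
  have h10 : δ * c ≤ c := mul_le_of_le_one_left hc (by linarith)
  rcases le_total R s with h | h
  · left
    have h5 := mul_le_mul_of_nonneg_left h (by linarith : 0 ≤ 1 / 2 - g)
    have h8 : 0 ≤ δ * (2 * P + 2 * Q + R - A) := mul_nonneg hδ (by linarith)
    nlinarith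
  · right
    have h5 := mul_le_mul_of_nonneg_left h hg
    have h8 : 0 ≤ δ * (2 * P + 2 * Q + 2 * R - A - s + 3 * c) := mul_nonneg hδ (by linarith)
    nlinarith

theorem log_bound_of_large_inner_near (hc : 0 ≤ c) (hg : 0 ≤ g) (hδ : 0 ≤ δ)
    (hγ : g + δ ≤ 1) (hP : 0 ≤ P) (hQ : 0 ≤ Q) (hR : 0 ≤ R) (he : e ≤ 0)
    (hx : e ≤ t + A + R + n)
    (hAP : A ≤ P) (hRA : R ≤ A + c) (hPQ : P ≤ Q + c) (hn : n ≤ A + c) :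
    e ≤ 10 * c + g * t + A + (g + δ) * (P + Q + R) - (1 + δ) / 2 * (A + R) := by
  have h1 : (1 - g) * e ≤ 0 := mul_nonpos_of_nonneg_of_nonpos (by linarith) he
  have h2 := mul_le_mul_of_nonneg_left hx hg
  have h3 := mul_le_mul_of_nonneg_left hn hg
  have h4 := mul_le_mul_of_nonneg_left hPQ hg
  have h5 := mul_le_mul_of_nonneg_left hAP hg
  have h6 : g * c ≤ c := mul_le_of_le_one_left hc (by linarith)
  have h10 : δ * c ≤ c := mul_le_of_le_one_left hc (by linarith)
  have h8 : 0 ≤ δ * (2 * P + 2 * Q + R - A + c) := mul_nonneg hδ (by linarith)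
  nlinarith

theorem log_bound_of_large_inner_high (hc : 0 ≤ c) (hg : 1 / 2 ≤ g) (hδ : 0 ≤ δ)
    (hγ : g + δ ≤ 1) (hP : 0 ≤ P) (hQ : 0 ≤ Q) (hR : 0 ≤ R) (he : e ≤ 0)
    (hx : e ≤ t + A + R + n) (hy : e ≤ t + P + Q + n)
    (hAP : A ≤ P) (hRP : R ≤ P) (hPQ : P ≤ Q + c) (hn : n ≤ R + c) :
    e ≤ 10 * c + g * t + A + (g + δ) * (P + Q + R) - (1 + δ) / 2 * (A + R) := by
  have h1 : (1 - g) * e ≤ 0 := mul_nonpos_of_nonneg_of_nonpos (by linarith) he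
  have h2 := mul_le_mul_of_nonneg_left hy (by linarith : 0 ≤ g - 1 / 2)
  have h3 := mul_le_mul_of_nonneg_left hn (by linarith : 0 ≤ g)
  have h4 := mul_le_mul_of_nonneg_left hPQ (by linarith : 0 ≤ g)
  have h5 := mul_le_mul_of_nonneg_left hRP (by linarith : 0 ≤ 1 - g)
  have h6 : g * c ≤ c := mul_le_of_le_one_left hc (by linarith)
  have h8 : 0 ≤ δ * (2 * P + 2 * Q + R - A) := mul_nonneg hδ (by linarith)
  nlinarith

/-- The same interpolation of the outer bound with the reciprocal full phase; now k₁+k₂ and k₁+k₃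
are both comparable with the large inputs, which is the term 2P in `hz`. -/
theorem log_bound_of_large_inner_low (hc : 0 ≤ c) (hg : 0 ≤ g) (hg' : g ≤ 1 / 2) (hδ : 0 ≤ δ)
    (hP : 0 ≤ P) (hQ : 0 ≤ Q) (hR : 0 ≤ R) (he : e ≤ 0)
    (hx : e ≤ t + A + R + n) (hz : e + t + n + 2 * P - 2 * c ≤ 0)
    (hAP : A ≤ P) (hRP : R ≤ P) (hPQ : P ≤ Q + c) (hn : n ≤ R + c) (hn' : R ≤ n + c) :
    e ≤ 10 * c + g * t + A + (g + δ) * (P + Q + R) - (1 + δ) / 2 * (A + R) := by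
  have h1 : g * e ≤ 0 := mul_nonpos_of_nonneg_of_nonpos (by linarith) he
  have h2 := mul_le_mul_of_nonneg_left hz (by linarith : 0 ≤ 1 / 2 - g)
  have h3 := mul_le_mul_of_nonneg_left hn' (by linarith : 0 ≤ 1 / 2 - g)
  have h4 := mul_le_mul_of_nonneg_left hPQ hg
  have h6 : g * c ≤ c := mul_le_of_le_one_left hc (by linarith)
  have h9 := mul_nonneg hg hc
  have h8 : 0 ≤ δ * (2 * P + 2 * Q + R - A) := mul_nonneg hδ (by linarith)
  nlinarith

/-- On the resonance k₂ = -k₁ one has k₃ = k and the full phase vanishes, so only the outer bound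
helps. It is used with weight g+δ; no decay has to be produced, and τ^δ ≤ 1. -/
theorem log_bound_of_resonance (hc : 0 ≤ c) (hg : 0 ≤ g) (hδ : 0 ≤ δ) (hγ : g + δ ≤ 1)
    (hA : 0 ≤ A) (hP : 0 ≤ P) (he : e ≤ 0) (ht : t ≤ 0) (hx : e ≤ t + A + P + n)
    (hn : n ≤ A + c ∨ n ≤ P + c) :
    e ≤ 10 * c + g * t + A + (g + δ) * (P + P + A) := by
  have h1 : (1 - (g + δ)) * e ≤ 0 := mul_nonpos_of_nonneg_of_nonpos (by linarith) he
  have h2 := mul_le_mul_of_nonneg_left hx (by linarith : 0 ≤ g + δ)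
  have h6 : (g + δ) * c ≤ c := mul_le_of_le_one_left hc (by linarith)
  have h7 : δ * t ≤ 0 := mul_nonpos_of_nonneg_of_nonpos hδ ht
  have h8 : (g + δ) * A ≤ A := mul_le_of_le_one_left hA hγ
  have h9 : 0 ≤ (g + δ) * P := by positivity
  rcases hn with hn | hn
  all_goals
    have h3 := mul_le_mul_of_nonneg_left hn (by linarith : 0 ≤ g + δ)
    nlinarith

end LogEstimates

/-! ### The pointwise kernel estimate -/

/-- The decaying weight `max(1, |k|) ^ (-(1 + δ) / 2)`, whose square is summable for `δ > 0`. -/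
def decay (δ : ℝ) (k : ℤ) : ℝ := (max 1 |(k : ℝ)|) ^ (-(1 + δ) / 2)

theorem decay_pos (δ : ℝ) (k : ℤ) : 0 < decay δ k :=
  Real.rpow_pos_of_pos (lt_max_of_lt_left one_pos) _

/-- The trilinear majorant attached to a weight `r`: products of two values of `r` at the
frequencies of a cubic interaction, and the indicators of the resonances. -/
def majorant (r : ℤ → ℝ) (k₁ k₂ k₃ : ℤ) : ℝ :=
  ((r k₁ * r k₂ + r k₁ * r k₃) + (r k₂ * r k₃ + if k₂ + k₃ = 0 then 1 else 0)) +
  (((r (k₁ + k₂ + k₃) * r k₁ + r (k₁ + k₂ + k₃) * r k₂) +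
    (r (k₁ + k₂ + k₃) * r k₃ + if k₁ + k₂ = 0 then 1 else 0)) +
  ((r (k₁ + k₂ + k₃) * r (k₁ + k₂) + r (k₁ + k₂ + k₃) * r (k₁ + k₃)) +
    if k₁ + k₃ = 0 then 1 else 0))

theorem majorant_swap (r : ℤ → ℝ) (k₁ k₂ k₃ : ℤ) :
    majorant r k₁ k₃ k₂ = majorant r k₁ k₂ k₃ := by
  simp only [majorant, add_right_comm k₁ k₃ k₂, add_comm k₃ k₂]
  ring

theorem log_le_log_add {x y c : ℝ} (hc : 0 < c) (hx : x ≠ 0) (hy : y ≠ 0) (h : |x| ≤ c * |y|) :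
    Real.log x ≤ Real.log y + Real.log c := by
  rw [← Real.log_abs x, ← Real.log_abs y, add_comm, ← Real.log_mul hc.ne' (abs_ne_zero.mpr hy)]
  exact Real.log_le_log (abs_pos.mpr hx) h

theorem log_le_log_of_abs_le {x y : ℝ} (hx : x ≠ 0) (h : |x| ≤ |y|) :
    Real.log x ≤ Real.log y := by
  rw [← Real.log_abs x, ← Real.log_abs y]
  exact Real.log_le_log (abs_pos.mpr hx) h

theorem log_intCast_nonneg (k : ℤ) : 0 ≤ Real.log (k : ℝ) := by
  rcases eq_or_ne k 0 with rfl | hk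
  · simp
  rw [← Real.log_abs]
  exact Real.log_nonneg (by exact_mod_cast Int.one_le_abs hk)

theorem decay_eq_exp (δ : ℝ) {k : ℤ} (hk : k ≠ 0) :
    decay δ k = Real.exp (-(1 + δ) / 2 * Real.log (k : ℝ)) := by
  have h1 : (1 : ℝ) ≤ |(k : ℝ)| := by exact_mod_cast Int.one_le_abs hk
  rw [decay, max_eq_right h1, Real.rpow_def_of_pos (by linarith), Real.log_abs, mul_comm]

theorem abs_rpow_eq_exp (γ : ℝ) {x : ℝ} (hx : x ≠ 0) :
    |x| ^ γ = Real.exp (γ * Real.log x) := by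
  rw [Real.rpow_def_of_pos (abs_pos.mpr hx), Real.log_abs, mul_comm]

/-- The passage back from logarithms. The constant 20^10 is e^(10c) with c = log 20. -/
theorem le_mul_decay_of_log_le {E τ g δ : ℝ} {k₁ k₂ k₃ k x y : ℤ} (hE : 0 < E) (hτ : 0 < τ)
    (hk₁ : k₁ ≠ 0) (hk₂ : k₂ ≠ 0) (hk₃ : k₃ ≠ 0) (hk : k ≠ 0) (hx : x ≠ 0) (hy : y ≠ 0)
    (h : Real.log E ≤ 10 * Real.log 20 + g * Real.log τ + Real.log k +
      (g + δ) * (Real.log k₁ + Real.log k₂ + Real.log k₃) -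
        (1 + δ) / 2 * (Real.log x + Real.log y)) :
    E ≤ 20 ^ 10 * τ ^ g * |(k : ℝ)| *
      (|(k₁ : ℝ)| ^ (g + δ) * |(k₂ : ℝ)| ^ (g + δ) * |(k₃ : ℝ)| ^ (g + δ)) *
      (decay δ x * decay δ y) := by
  have c1 : (k₁ : ℝ) ≠ 0 := by exact_mod_cast hk₁
  have c2 : (k₂ : ℝ) ≠ 0 := by exact_mod_cast hk₂
  have c3 : (k₃ : ℝ) ≠ 0 := by exact_mod_cast hk₃
  have c0 : (k : ℝ) ≠ 0 := by exact_mod_cast hk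
  have e1 : |(k : ℝ)| = Real.exp (Real.log k) := (Real.exp_log_eq_abs c0).symm
  have e2 : (20 : ℝ) ^ 10 = Real.exp (10 * Real.log 20) := by
    rw [mul_comm, ← Real.rpow_def_of_pos (by norm_num)]; norm_num
  rw [abs_rpow_eq_exp _ c1, abs_rpow_eq_exp _ c2, abs_rpow_eq_exp _ c3, decay_eq_exp δ hx,
    decay_eq_exp δ hy, e1, e2, Real.rpow_def_of_pos hτ]
  simp only [← Real.exp_add]
  rw [← Real.exp_log hE]
  apply Real.exp_le_exp.mpr
  linarith

theorem le_mul_of_log_le {E τ g δ : ℝ} {k₁ k₂ k₃ k : ℤ} (hE : 0 < E) (hτ : 0 < τ)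
    (hk₁ : k₁ ≠ 0) (hk₂ : k₂ ≠ 0) (hk₃ : k₃ ≠ 0) (hk : k ≠ 0)
    (h : Real.log E ≤ 10 * Real.log 20 + g * Real.log τ + Real.log k +
      (g + δ) * (Real.log k₁ + Real.log k₂ + Real.log k₃)) :
    E ≤ 20 ^ 10 * τ ^ g * |(k : ℝ)| *
      (|(k₁ : ℝ)| ^ (g + δ) * |(k₂ : ℝ)| ^ (g + δ) * |(k₃ : ℝ)| ^ (g + δ)) := by
  -- The decay weight equals 1 at frequency 1, so placing it there removes it.
  simpa [decay] using le_mul_decay_of_log_le (x := 1) (y := 1) hE hτ hk₁ hk₂ hk₃ hk one_ne_zero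
    one_ne_zero (by simpa using h)

/-- The bounds satisfied by (a multiple of) the phase mismatch kernel at a cubic interaction. -/
structure MismatchBound (τ E : ℝ) (k₁ k₂ k₃ : ℤ) : Prop where
  nonneg : 0 ≤ E
  le_one : E ≤ 1
  le_outer : E ≤ τ * |((k₁ : ℝ) + k₂ + k₃) * k₁ * (k₂ + k₃)|
  le_inner : E ≤ τ * |(k₂ : ℝ) * k₃ * (k₂ + k₃)|
  mul_le_one : E * (τ * |((k₂ : ℝ) + k₃) * (k₁ + k₃) * (k₁ + k₂)|) ≤ 1

theorem MismatchBound.swap {τ E : ℝ} {k₁ k₂ k₃ : ℤ} (h : MismatchBound τ E k₁ k₂ k₃) :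
    MismatchBound τ E k₁ k₃ k₂ where
  nonneg := h.nonneg
  le_one := h.le_one
  le_outer := by convert h.le_outer using 4 <;> ring
  le_inner := by convert h.le_inner using 3; ring
  mul_le_one := by convert h.mul_le_one using 4; ring

/-- The product of weights against which the kernel is estimated. -/
def kernelScale (τ g δ : ℝ) (k₁ k₂ k₃ : ℤ) : ℝ :=
  20 ^ 10 * τ ^ g * |((k₁ + k₂ + k₃ : ℤ) : ℝ)| *
    (|(k₁ : ℝ)| ^ (g + δ) * |(k₂ : ℝ)| ^ (g + δ) * |(k₃ : ℝ)| ^ (g + δ))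

theorem kernelScale_nonneg {τ : ℝ} (hτ : 0 < τ) (g δ : ℝ) (k₁ k₂ k₃ : ℤ) :
    0 ≤ kernelScale τ g δ k₁ k₂ k₃ := by
  have := Real.rpow_pos_of_pos hτ g
  unfold kernelScale
  positivity

theorem kernelScale_swap (τ g δ : ℝ) (k₁ k₂ k₃ : ℤ) :
    kernelScale τ g δ k₁ k₃ k₂ = kernelScale τ g δ k₁ k₂ k₃ := by
  simp only [kernelScale, add_right_comm k₁ k₃ k₂]
  ring

theorem mul_pair_le_majorant {r : ℤ → ℝ} (hr : ∀ k, 0 < r k) {k₁ k₂ k₃ : ℤ} {c E : ℝ}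
    (hc : 0 ≤ c)
    (h : E ≤ c * (r k₁ * r k₂) ∨ E ≤ c * (r k₁ * r k₃) ∨ E ≤ c * (r k₂ * r k₃) ∨
      E ≤ c * (r (k₁ + k₂ + k₃) * r k₁) ∨ E ≤ c * (r (k₁ + k₂ + k₃) * r k₂) ∨
      E ≤ c * (r (k₁ + k₂ + k₃) * r k₃) ∨ E ≤ c * (r (k₁ + k₂ + k₃) * r (k₁ + k₂)) ∨
      E ≤ c * (r (k₁ + k₂ + k₃) * r (k₁ + k₃)) ∨ (k₁ + k₂ = 0 ∧ E ≤ c) ∨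
      (k₁ + k₃ = 0 ∧ E ≤ c) ∨ (k₂ + k₃ = 0 ∧ E ≤ c)) :
    E ≤ c * majorant r k₁ k₂ k₃ := by
  have p1 := hr k₁
  have p2 := hr k₂
  have p3 := hr k₃
  have p0 := hr (k₁ + k₂ + k₃)
  have p12 := hr (k₁ + k₂)
  have p13 := hr (k₁ + k₃)
  have q1 := mul_pos p1 p2
  have q2 := mul_pos p1 p3
  have q3 := mul_pos p2 p3
  have q4 := mul_pos p0 p1
  have q5 := mul_pos p0 p2
  have q6 := mul_pos p0 p3
  have q7 := mul_pos p0 p12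
  have q8 := mul_pos p0 p13
  have i1 : (0 : ℝ) ≤ if k₂ + k₃ = 0 then 1 else 0 := by positivity
  have i2 : (0 : ℝ) ≤ if k₁ + k₂ = 0 then 1 else 0 := by positivity
  have i3 : (0 : ℝ) ≤ if k₁ + k₃ = 0 then 1 else 0 := by positivity
  unfold majorant
  rcases h with h | h | h | h | h | h | h | h | ⟨h0, h⟩ | ⟨h0, h⟩ | ⟨h0, h⟩
  iterate 8
    refine h.trans (mul_le_mul_of_nonneg_left ?_ hc)
    linarith
  all_goals
    refine (h.trans_eq (mul_one c).symm).trans (mul_le_mul_of_nonneg_left ?_ hc)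
    rw [if_pos h0] at *
    linarith

section Estimate

variable {τ g δ E : ℝ} {k₁ k₂ k₃ : ℤ}

/-- If k₂+k₃ = 0 both phases vanish and so does the kernel. The indicator of this resonance in the
majorant is needed only for the integrator's own kernel. -/
theorem MismatchBound.ne_zero (h : MismatchBound τ E k₁ k₂ k₃) (hE : 0 < E) :
    k₁ ≠ 0 ∧ k₂ ≠ 0 ∧ k₃ ≠ 0 ∧ k₂ + k₃ ≠ 0 := by
  have h1 := h.le_outer
  have h2 := h.le_inner
  refine ⟨?_, ?_, ?_, fun h0 => ?_⟩
  · rintro rfl; simp at h1; linarith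
  · rintro rfl; simp at h2; linarith
  · rintro rfl; simp at h2; linarith
  · have : (k₂ : ℝ) + k₃ = 0 := by exact_mod_cast h0
    simp [this] at h1; linarith

theorem MismatchBound.log_outer (h : MismatchBound τ E k₁ k₂ k₃) (hE : 0 < E) (hτ : 0 < τ)
    (hk : k₁ + k₂ + k₃ ≠ 0) :
    Real.log E ≤ Real.log τ + Real.log ((k₁ + k₂ + k₃ : ℤ) : ℝ) + Real.log k₁ +
      Real.log ((k₂ + k₃ : ℤ) : ℝ) := by
  obtain ⟨h1, h2, h3, h4⟩ := h.ne_zero hE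
  have c1 : (k₁ : ℝ) ≠ 0 := by exact_mod_cast h1
  have c4 : ((k₂ + k₃ : ℤ) : ℝ) ≠ 0 := by exact_mod_cast h4
  have c0 : ((k₁ + k₂ + k₃ : ℤ) : ℝ) ≠ 0 := by exact_mod_cast hk
  rw [add_assoc, add_assoc, ← Real.log_mul c1 c4, ← Real.log_mul c0 (mul_ne_zero c1 c4),
    ← Real.log_abs (_ * _), ← Real.log_mul hτ.ne' (by positivity)]
  refine Real.log_le_log hE (h.le_outer.trans_eq ?_)
  push_cast; ring_nf

theorem MismatchBound.log_inner (h : MismatchBound τ E k₁ k₂ k₃) (hE : 0 < E) (hτ : 0 < τ) :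
    Real.log E ≤ Real.log τ + Real.log k₂ + Real.log k₃ + Real.log ((k₂ + k₃ : ℤ) : ℝ) := by
  obtain ⟨h1, h2, h3, h4⟩ := h.ne_zero hE
  have c2 : (k₂ : ℝ) ≠ 0 := by exact_mod_cast h2
  have c3 : (k₃ : ℝ) ≠ 0 := by exact_mod_cast h3
  have c4 : ((k₂ + k₃ : ℤ) : ℝ) ≠ 0 := by exact_mod_cast h4
  rw [add_assoc, add_assoc, ← Real.log_mul c3 c4, ← Real.log_mul c2 (mul_ne_zero c3 c4),
    ← Real.log_abs (_ * _), ← Real.log_mul hτ.ne' (by positivity)]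
  refine Real.log_le_log hE (h.le_inner.trans_eq ?_)
  push_cast; ring_nf

theorem MismatchBound.log_full (h : MismatchBound τ E k₁ k₂ k₃) (hE : 0 < E) (hτ : 0 < τ)
    (h13 : k₁ + k₃ ≠ 0) (h12 : k₁ + k₂ ≠ 0) :
    Real.log E + (Real.log τ + Real.log ((k₂ + k₃ : ℤ) : ℝ) + Real.log ((k₁ + k₃ : ℤ) : ℝ) +
      Real.log ((k₁ + k₂ : ℤ) : ℝ)) ≤ 0 := by
  obtain ⟨h1, h2, h3, h4⟩ := h.ne_zero hE
  have c2 : ((k₁ + k₃ : ℤ) : ℝ) ≠ 0 := by exact_mod_cast h13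
  have c3 : ((k₁ + k₂ : ℤ) : ℝ) ≠ 0 := by exact_mod_cast h12
  have c4 : ((k₂ + k₃ : ℤ) : ℝ) ≠ 0 := by exact_mod_cast h4
  rw [add_assoc, add_assoc, ← Real.log_mul c2 c3, ← Real.log_mul c4 (mul_ne_zero c2 c3),
    ← Real.log_abs (_ * _), ← Real.log_mul hτ.ne' (by positivity),
    ← Real.log_mul hE.ne' (by positivity)]
  refine Real.log_nonpos (by positivity) (le_of_eq_of_le ?_ h.mul_le_one)
  push_cast; ring_nf

theorem abs_three (k₁ k₂ k₃ : ℤ) :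
    |(k₁ : ℝ)| ≤ |((k₁ + k₂ + k₃ : ℤ) : ℝ)| + |(k₂ : ℝ)| + |(k₃ : ℝ)| ∧
    |(k₂ : ℝ)| ≤ |((k₁ + k₂ + k₃ : ℤ) : ℝ)| + |(k₁ : ℝ)| + |(k₃ : ℝ)| ∧
    |(k₃ : ℝ)| ≤ |((k₁ + k₂ + k₃ : ℤ) : ℝ)| + |(k₁ : ℝ)| + |(k₂ : ℝ)| ∧
    |((k₁ + k₂ + k₃ : ℤ) : ℝ)| ≤ |(k₁ : ℝ)| + |(k₂ : ℝ)| + |(k₃ : ℝ)| ∧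
    |((k₂ + k₃ : ℤ) : ℝ)| ≤ |((k₁ + k₂ + k₃ : ℤ) : ℝ)| + |(k₁ : ℝ)| ∧
    |((k₁ + k₃ : ℤ) : ℝ)| ≤ |((k₁ + k₂ + k₃ : ℤ) : ℝ)| + |(k₂ : ℝ)| ∧
    |((k₁ + k₂ : ℤ) : ℝ)| ≤ |((k₁ + k₂ + k₃ : ℤ) : ℝ)| + |(k₃ : ℝ)| ∧
    |(k₁ : ℝ)| ≤ |((k₂ + k₃ : ℤ) : ℝ)| + |((k₁ + k₂ + k₃ : ℤ) : ℝ)| ∧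
    |(k₂ : ℝ)| ≤ |((k₁ + k₃ : ℤ) : ℝ)| + |((k₁ + k₂ + k₃ : ℤ) : ℝ)| ∧
    |(k₃ : ℝ)| ≤ |((k₁ + k₂ : ℤ) : ℝ)| + |((k₁ + k₂ + k₃ : ℤ) : ℝ)| := by
  have key : ∀ x y : ℝ, |x + y| ≤ |x| + |y| := abs_add_le
  have key' : ∀ x y : ℝ, |x - y| ≤ |x| + |y| := fun x y => abs_sub x y
  push_cast
  generalize (k₁ : ℝ) = x
  generalize (k₂ : ℝ) = y
  generalize (k₃ : ℝ) = z
  refine ⟨?_, ?_, ?_, ?_, ?_, ?_, ?_, ?_, ?_, ?_⟩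
  · have := key' (x + y + z) y; have := key' (x + y + z - y) z
    rw [show x + y + z - y - z = x by ring] at this; linarith
  · have := key' (x + y + z) x; have := key' (x + y + z - x) z
    rw [show x + y + z - x - z = y by ring] at this; linarith
  · have := key' (x + y + z) x; have := key' (x + y + z - x) y
    rw [show x + y + z - x - y = z by ring] at this; linarith
  · exact abs_add_three _ _ _
  · have := key' (x + y + z) x; rwa [show x + y + z - x = y + z by ring] at this
  · have := key' (x + y + z) y; rwa [show x + y + z - y = x + z by ring] at this
  · have := key' (x + y + z) z; rwa [show x + y + z - z = x + y by ring] at this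
  · have := key' (x + y + z) (y + z); rw [show x + y + z - (y + z) = x by ring] at this; linarith
  · have := key' (x + y + z) (x + z); rw [show x + y + z - (x + z) = y by ring] at this; linarith
  · have := key' (x + y + z) (x + y); rw [show x + y + z - (x + y) = z by ring] at this; linarith

end Estimate

section Estimate

variable {τ g δ E : ℝ} {k₁ k₂ k₃ : ℤ}

/-- The largest input is comparable with the output, since it also is at least a third of it. The
case distinction only finds the largest input; the other two carry the decay. -/
theorem MismatchBound.le_majorant_of_large_output (h : MismatchBound τ E k₁ k₂ k₃) (hE : 0 < E)
    (hτ : 0 < τ) (hg : 0 ≤ g) (hδ : 0 ≤ δ) (hγ : g + δ ≤ 1) (hk : k₁ + k₂ + k₃ ≠ 0)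
    (h1 : |(k₁ : ℝ)| ≤ 10 * |((k₁ + k₂ + k₃ : ℤ) : ℝ)|)
    (h2 : |(k₂ : ℝ)| ≤ 10 * |((k₁ + k₂ + k₃ : ℤ) : ℝ)|)
    (h3 : |(k₃ : ℝ)| ≤ 10 * |((k₁ + k₂ + k₃ : ℤ) : ℝ)|) :
    E ≤ kernelScale τ g δ k₁ k₂ k₃ * majorant (decay δ) k₁ k₂ k₃ := by
  obtain ⟨z1, z2, z3, zn⟩ := h.ne_zero hE
  obtain ⟨-, -, -, t4, t5, -⟩ := abs_three k₁ k₂ k₃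
  have hX := h.log_outer hE hτ hk
  have hY := h.log_inner hE hτ
  have c1 : (k₁ : ℝ) ≠ 0 := by exact_mod_cast z1
  have c2 : (k₂ : ℝ) ≠ 0 := by exact_mod_cast z2
  have c3 : (k₃ : ℝ) ≠ 0 := by exact_mod_cast z3
  have cn : ((k₂ + k₃ : ℤ) : ℝ) ≠ 0 := by exact_mod_cast zn
  have c0 : ((k₁ + k₂ + k₃ : ℤ) : ℝ) ≠ 0 := by exact_mod_cast hk
  have he : Real.log E ≤ 0 := Real.log_nonpos hE.le h.le_one
  have hc : 0 ≤ Real.log 20 := Real.log_nonneg (by norm_num)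
  have l0 := log_intCast_nonneg (k₁ + k₂ + k₃)
  have l1 := log_intCast_nonneg k₁
  have l2 := log_intCast_nonneg k₂
  have l3 := log_intCast_nonneg k₃
  have a0 := abs_nonneg ((k₁ + k₂ + k₃ : ℤ) : ℝ)
  have hn := log_le_log_add (c := 20) (by norm_num) cn c0 (by linarith)
  have m1 := log_le_log_add (c := 20) (by norm_num) c1 c0 (by linarith)
  have m2 := log_le_log_add (c := 20) (by norm_num) c2 c0 (by linarith)
  have m3 := log_le_log_add (c := 20) (by norm_num) c3 c0 (by linarith)
  refine mul_pair_le_majorant (decay_pos δ) (kernelScale_nonneg hτ _ _ _ _ _) ?_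
  rcases le_total |(k₁ : ℝ)| |(k₂ : ℝ)| with h12 | h12
  · rcases le_total |(k₂ : ℝ)| |(k₃ : ℝ)| with h23 | h23
    · left
      refine le_mul_decay_of_log_le hE hτ z1 z2 z3 hk z1 z2 ?_
      have := log_bound_of_large_output hc hg hδ hγ l3 l1 l2 he (A := Real.log (k₁ + k₂ + k₃ : ℤ))
        (n := Real.log (k₂ + k₃ : ℤ)) (t := Real.log τ) (by linarith)
        (log_le_log_add (by norm_num) c0 c3 (by linarith)) m3
        (log_le_log_of_abs_le c1 (h12.trans h23)) (log_le_log_of_abs_le c2 h23) hn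
      linarith
    · right; left
      refine le_mul_decay_of_log_le hE hτ z1 z2 z3 hk z1 z3 ?_
      have := log_bound_of_large_output hc hg hδ hγ l2 l1 l3 he (A := Real.log (k₁ + k₂ + k₃ : ℤ))
        (n := Real.log (k₂ + k₃ : ℤ)) (t := Real.log τ) (by linarith)
        (log_le_log_add (by norm_num) c0 c2 (by linarith)) m2
        (log_le_log_of_abs_le c1 h12) (log_le_log_of_abs_le c3 h23) hn
      linarith
  · rcases le_total |(k₁ : ℝ)| |(k₃ : ℝ)| with h23 | h23
    · left
      refine le_mul_decay_of_log_le hE hτ z1 z2 z3 hk z1 z2 ?_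
      have := log_bound_of_large_output hc hg hδ hγ l3 l1 l2 he (A := Real.log (k₁ + k₂ + k₃ : ℤ))
        (n := Real.log (k₂ + k₃ : ℤ)) (t := Real.log τ) (by linarith)
        (log_le_log_add (by norm_num) c0 c3 (by linarith)) m3
        (log_le_log_of_abs_le c1 h23) (log_le_log_of_abs_le c2 (h12.trans h23)) hn
      linarith
    · right; right; left
      refine le_mul_decay_of_log_le hE hτ z1 z2 z3 hk z2 z3 ?_
      have := log_bound_of_large_output hc hg hδ hγ l1 l2 l3 he (A := Real.log (k₁ + k₂ + k₃ : ℤ))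
        (n := Real.log (k₂ + k₃ : ℤ)) (t := Real.log τ) (by linarith)
        (log_le_log_add (by norm_num) c0 c1 (by linarith)) m1
        (log_le_log_of_abs_le c2 h12) (log_le_log_of_abs_le c3 h23) hn
      linarith

/-- The small output forces the two largest inputs k₁ and k₂ nearly to cancel, hence to be
comparable. The decay sits at the output and at k₃ or k₁+k₂; the case k₁+k₂ = 0 gives an indicator.
-/
theorem MismatchBound.le_majorant_of_large_outer (h : MismatchBound τ E k₁ k₂ k₃) (hE : 0 < E)
    (hτ : 0 < τ) (hτ1 : τ ≤ 1) (hg : 0 ≤ g) (hδ : 0 ≤ δ) (hγ : g + δ ≤ 1)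
    (hk : k₁ + k₂ + k₃ ≠ 0)
    (h0 : 10 * |((k₁ + k₂ + k₃ : ℤ) : ℝ)| ≤ max |(k₁ : ℝ)| |(k₂ : ℝ)|)
    (h31 : |(k₃ : ℝ)| ≤ |(k₁ : ℝ)|) (h32 : |(k₃ : ℝ)| ≤ |(k₂ : ℝ)|) :
    E ≤ kernelScale τ g δ k₁ k₂ k₃ * majorant (decay δ) k₁ k₂ k₃ := by
  obtain ⟨z1, z2, z3, zn⟩ := h.ne_zero hE
  obtain ⟨t1, t2, t3, t4, t5, t6, t7, t8, t9, t10⟩ := abs_three k₁ k₂ k₃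
  have hX := h.log_outer hE hτ hk
  have hY := h.log_inner hE hτ
  have c1 : (k₁ : ℝ) ≠ 0 := by exact_mod_cast z1
  have c2 : (k₂ : ℝ) ≠ 0 := by exact_mod_cast z2
  have c3 : (k₃ : ℝ) ≠ 0 := by exact_mod_cast z3
  have cn : ((k₂ + k₃ : ℤ) : ℝ) ≠ 0 := by exact_mod_cast zn
  have c0 : ((k₁ + k₂ + k₃ : ℤ) : ℝ) ≠ 0 := by exact_mod_cast hk
  have he : Real.log E ≤ 0 := Real.log_nonpos hE.le h.le_one
  have hc : 0 ≤ Real.log 20 := Real.log_nonneg (by norm_num)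
  have l0 := log_intCast_nonneg (k₁ + k₂ + k₃)
  have l1 := log_intCast_nonneg k₁
  have l2 := log_intCast_nonneg k₂
  have l3 := log_intCast_nonneg k₃
  have a0 := abs_nonneg ((k₁ + k₂ + k₃ : ℤ) : ℝ)
  have a1 := abs_pos.mpr c1
  have a2 := abs_pos.mpr c2
  have hcmp : |(k₁ : ℝ)| ≤ 3 * |(k₂ : ℝ)| ∧ |(k₂ : ℝ)| ≤ 3 * |(k₁ : ℝ)| := by
    rcases max_cases |(k₁ : ℝ)| |(k₂ : ℝ)| with ⟨hm, -⟩ | ⟨hm, -⟩ <;> rw [hm] at h0 <;>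
      constructor <;> linarith
  have h01 : 3 * |((k₁ + k₂ + k₃ : ℤ) : ℝ)| ≤ |(k₁ : ℝ)| ∧
      3 * |((k₁ + k₂ + k₃ : ℤ) : ℝ)| ≤ |(k₂ : ℝ)| := by
    rcases max_cases |(k₁ : ℝ)| |(k₂ : ℝ)| with ⟨hm, -⟩ | ⟨hm, -⟩ <;> rw [hm] at h0 <;>
      constructor <;> linarith
  have hA : Real.log ((k₁ + k₂ + k₃ : ℤ) : ℝ) ≤ Real.log k₁ :=
    log_le_log_of_abs_le c0 (by linarith)
  have hn := log_le_log_add (c := 20) (by norm_num) cn c1 (by linarith)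
  have h12 := log_le_log_add (c := 20) (by norm_num) c1 c2 (by linarith)
  have h21 := log_le_log_add (c := 20) (by norm_num) c2 c1 (by linarith)
  refine mul_pair_le_majorant (decay_pos δ) (kernelScale_nonneg hτ _ _ _ _ _) ?_
  rcases le_total (1 / 2) g with hg2 | hg2
  · right; right; right; right; right; left
    refine le_mul_decay_of_log_le hE hτ z1 z2 z3 hk hk z3 ?_
    exact log_bound_of_large_outer_high hc hg2 hδ hγ l1 l2 l3 he hX hY hA h12 hn
  by_cases hs : k₁ + k₂ = 0
  · right; right; right; right; right; right; right; right; left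
    refine ⟨hs, le_mul_of_log_le hE hτ z1 z2 z3 hk ?_⟩
    have e3 : k₁ + k₂ + k₃ = k₃ := by omega
    have e2 : Real.log (k₂ : ℝ) = Real.log k₁ := by
      rw [show k₂ = -k₁ by omega]; push_cast; exact Real.log_neg_eq_log _
    have := log_bound_of_resonance hc hg hδ hγ l0 l1 he (Real.log_nonpos hτ.le hτ1) hX (Or.inr hn)
    rw [e3] at this ⊢
    rw [e2]
    exact this
  · have cs : ((k₁ + k₂ : ℤ) : ℝ) ≠ 0 := by exact_mod_cast hs
    -- The other pair sum is large: |k₂| ≤ |k₁+k₃| + |k| and 3|k| ≤ |k₂|.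
    have cq' : 0 < |((k₁ + k₃ : ℤ) : ℝ)| := by linarith
    have cq : ((k₁ + k₃ : ℤ) : ℝ) ≠ 0 := abs_pos.mp cq'
    have hZ := h.log_full hE hτ (by exact_mod_cast cq) hs
    have b1 := log_le_log_add (c := 20) (by norm_num) c1 cn (by linarith)
    have b2 := log_le_log_add (c := 20) (by norm_num) c1 cq (by linarith)
    have b3 := log_le_log_add (c := 20) (by norm_num) cs c1 (by linarith)
    rcases log_bound_of_large_outer_low hc hg hg2 hδ hγ l1 l2 l3 he hX
      (s := Real.log (k₁ + k₂ : ℤ)) (by linarith) hA h12 hn b3 with h4 | h4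
    · right; right; right; right; right; left
      exact le_mul_decay_of_log_le hE hτ z1 z2 z3 hk hk z3 h4
    · right; right; right; right; right; right; left
      exact le_mul_decay_of_log_le hE hτ z1 z2 z3 hk hk hs h4

/-- Here the smallest input is k₁, and the decay sits at the output and at k₁. There is no resonance
to separate: k₁+k₂ and k₁+k₃ cannot vanish, because |k₂| and |k₃| are at least 3|k|. -/
theorem MismatchBound.le_majorant_of_large_inner (h : MismatchBound τ E k₁ k₂ k₃) (hE : 0 < E)
    (hτ : 0 < τ) (hg : 0 ≤ g) (hδ : 0 ≤ δ) (hγ : g + δ ≤ 1)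
    (hk : k₁ + k₂ + k₃ ≠ 0)
    (h0 : 10 * |((k₁ + k₂ + k₃ : ℤ) : ℝ)| ≤ max |(k₂ : ℝ)| |(k₃ : ℝ)|)
    (h12 : |(k₁ : ℝ)| ≤ |(k₂ : ℝ)|) (h13 : |(k₁ : ℝ)| ≤ |(k₃ : ℝ)|) :
    E ≤ kernelScale τ g δ k₁ k₂ k₃ * majorant (decay δ) k₁ k₂ k₃ := by
  obtain ⟨z1, z2, z3, zn⟩ := h.ne_zero hE
  obtain ⟨t1, t2, t3, t4, t5, t6, t7, t8, t9, t10⟩ := abs_three k₁ k₂ k₃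
  have hX := h.log_outer hE hτ hk
  have hY := h.log_inner hE hτ
  have c1 : (k₁ : ℝ) ≠ 0 := by exact_mod_cast z1
  have c2 : (k₂ : ℝ) ≠ 0 := by exact_mod_cast z2
  have c3 : (k₃ : ℝ) ≠ 0 := by exact_mod_cast z3
  have cn : ((k₂ + k₃ : ℤ) : ℝ) ≠ 0 := by exact_mod_cast zn
  have c0 : ((k₁ + k₂ + k₃ : ℤ) : ℝ) ≠ 0 := by exact_mod_cast hk
  have he : Real.log E ≤ 0 := Real.log_nonpos hE.le h.le_one
  have hc : 0 ≤ Real.log 20 := Real.log_nonneg (by norm_num)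
  have l1 := log_intCast_nonneg k₁
  have l2 := log_intCast_nonneg k₂
  have l3 := log_intCast_nonneg k₃
  have a0 := abs_nonneg ((k₁ + k₂ + k₃ : ℤ) : ℝ)
  have a2 := abs_pos.mpr c2
  have a3 := abs_pos.mpr c3
  have hcmp : |(k₂ : ℝ)| ≤ 3 * |(k₃ : ℝ)| ∧ |(k₃ : ℝ)| ≤ 3 * |(k₂ : ℝ)| := by
    rcases max_cases |(k₂ : ℝ)| |(k₃ : ℝ)| with ⟨hm, -⟩ | ⟨hm, -⟩ <;> rw [hm] at h0 <;>
      constructor <;> linarith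
  have h01 : 3 * |((k₁ + k₂ + k₃ : ℤ) : ℝ)| ≤ |(k₂ : ℝ)| ∧
      3 * |((k₁ + k₂ + k₃ : ℤ) : ℝ)| ≤ |(k₃ : ℝ)| := by
    rcases max_cases |(k₂ : ℝ)| |(k₃ : ℝ)| with ⟨hm, -⟩ | ⟨hm, -⟩ <;> rw [hm] at h0 <;>
      constructor <;> linarith
  have hA : Real.log ((k₁ + k₂ + k₃ : ℤ) : ℝ) ≤ Real.log k₂ :=
    log_le_log_of_abs_le c0 (by linarith)
  have h23 := log_le_log_add (c := 20) (by norm_num) c2 c3 (by linarith)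
  have h32 := log_le_log_add (c := 20) (by norm_num) c3 c2 (by linarith)
  have hR := log_le_log_of_abs_le c1 h12
  refine mul_pair_le_majorant (decay_pos δ) (kernelScale_nonneg hτ _ _ _ _ _) ?_
  right; right; right; left
  refine le_mul_decay_of_log_le hE hτ z1 z2 z3 hk hk z1 ?_
  rcases le_total |(k₁ : ℝ)| (10 * |((k₁ + k₂ + k₃ : ℤ) : ℝ)|) with h10 | h10
  · have := log_bound_of_large_inner_near hc hg hδ hγ l2 l3 l1 he hX hA
      (log_le_log_add (by norm_num) c1 c0 (by linarith)) h23
      (log_le_log_add (by norm_num) cn c0 (by linarith))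
    linarith
  have hn := log_le_log_add (c := 20) (by norm_num) cn c1 (by linarith)
  have hn' := log_le_log_add (c := 20) (by norm_num) c1 cn (by linarith)
  rcases le_total (1 / 2) g with hg2 | hg2
  · have := log_bound_of_large_inner_high hc hg2 hδ hγ l2 l3 l1 he hX hY hA hR h23 hn
    linarith
  · have cq' : 0 < |((k₁ + k₃ : ℤ) : ℝ)| := by linarith
    have cq : ((k₁ + k₃ : ℤ) : ℝ) ≠ 0 := abs_pos.mp cq'
    have cs' : 0 < |((k₁ + k₂ : ℤ) : ℝ)| := by linarith
    have cs : ((k₁ + k₂ : ℤ) : ℝ) ≠ 0 := abs_pos.mp cs'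
    have hZ := h.log_full hE hτ (by exact_mod_cast cq) (by exact_mod_cast cs)
    have b1 := log_le_log_add (c := 20) (by norm_num) c2 cq (by linarith)
    have b2 := log_le_log_add (c := 20) (by norm_num) c2 cs (by linarith)
    have := log_bound_of_large_inner_low hc hg hg2 hδ l2 l3 l1 he hX (by linarith) hA hR h23 hn hn'
    linarith

/-- The pointwise estimate of the phase mismatch kernel: a gain of `τ ^ g` against `g + δ`
derivatives on each factor. -/
theorem MismatchBound.le_majorant (h : MismatchBound τ E k₁ k₂ k₃)
    (hτ : 0 < τ) (hτ1 : τ ≤ 1) (hg : 0 ≤ g) (hδ : 0 ≤ δ) (hγ : g + δ ≤ 1)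
    (hk : k₁ + k₂ + k₃ ≠ 0) :
    E ≤ kernelScale τ g δ k₁ k₂ k₃ * majorant (decay δ) k₁ k₂ k₃ := by
  rcases h.nonneg.eq_or_lt with hE | hE
  · rw [← hE]
    exact mul_pair_le_majorant (decay_pos δ) (kernelScale_nonneg hτ _ _ _ _ _)
      (Or.inl (mul_nonneg (kernelScale_nonneg hτ _ _ _ _ _)
        (mul_nonneg (decay_pos δ _).le (decay_pos δ _).le)))
  by_cases hbig : |(k₁ : ℝ)| ≤ 10 * |((k₁ + k₂ + k₃ : ℤ) : ℝ)| ∧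
      |(k₂ : ℝ)| ≤ 10 * |((k₁ + k₂ + k₃ : ℤ) : ℝ)| ∧
      |(k₃ : ℝ)| ≤ 10 * |((k₁ + k₂ + k₃ : ℤ) : ℝ)|
  · exact h.le_majorant_of_large_output hE hτ hg hδ hγ hk hbig.1 hbig.2.1 hbig.2.2
  have hsmall : 10 * |((k₁ + k₂ + k₃ : ℤ) : ℝ)| ≤
      max |(k₁ : ℝ)| (max |(k₂ : ℝ)| |(k₃ : ℝ)|) := by
    by_contra hcon
    rw [not_le, max_lt_iff, max_lt_iff] at hcon
    exact hbig ⟨hcon.1.le, hcon.2.1.le, hcon.2.2.le⟩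
  by_cases h3 : |(k₃ : ℝ)| ≤ |(k₁ : ℝ)| ∧ |(k₃ : ℝ)| ≤ |(k₂ : ℝ)|
  · refine h.le_majorant_of_large_outer hE hτ hτ1 hg hδ hγ hk ?_ h3.1 h3.2
    rwa [max_eq_left h3.2] at hsmall
  -- The bounds are symmetric only under the exchange of k₂ and k₃. It reduces a smallest k₂ to a
  -- smallest k₃, while a smallest k₁ is a case of its own.
  by_cases h2 : |(k₂ : ℝ)| ≤ |(k₁ : ℝ)| ∧ |(k₂ : ℝ)| ≤ |(k₃ : ℝ)|
  · have e : k₁ + k₃ + k₂ = k₁ + k₂ + k₃ := by ring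
    rw [← kernelScale_swap, ← majorant_swap]
    refine h.swap.le_majorant_of_large_outer hE hτ hτ1 hg hδ hγ (by rwa [e]) ?_ h2.1 h2.2
    rwa [max_eq_right h2.2, ← e] at hsmall
  have h1 : |(k₁ : ℝ)| ≤ |(k₂ : ℝ)| ∧ |(k₁ : ℝ)| ≤ |(k₃ : ℝ)| := by
    grind
  refine h.le_majorant_of_large_inner hE hτ hg hδ hγ hk ?_ h1.1 h1.2
  rwa [max_eq_right (h1.1.trans (le_max_left _ _))] at hsmall

end Estimate

/-! ### Trilinear convolution estimates -/

/-- Cauchy–Schwarz, as Hölder's inequality for the counting measure; with values in `ℝ≥0∞` no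
summability has to be checked. -/
theorem sq_tsum_mul_le {ι : Type*} (F G : ι → ℝ≥0∞) :
    (∑' i, F i * G i) ^ 2 ≤ (∑' i, F i ^ 2) * ∑' i, G i ^ 2 := by
  let : MeasurableSpace ι := ⊤
  have h := ENNReal.lintegral_mul_le_Lp_mul_Lq (Measure.count : Measure ι)
    Real.HolderConjugate.two_two (f := F) (g := G) (Measurable.of_discrete).aemeasurable
    (Measurable.of_discrete).aemeasurable
  simp only [lintegral_count, Pi.mul_apply, ENNReal.rpow_two] at h
  have h2 := pow_le_pow_left' h 2
  refine h2.trans_eq ?_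
  rw [mul_pow, ← ENNReal.rpow_natCast, ← ENNReal.rpow_natCast, ← ENNReal.rpow_mul,
    ← ENNReal.rpow_mul]
  norm_num

theorem add_sq_le_four_mul (x y : ℝ≥0∞) : (x + y) ^ 2 ≤ 4 * (x ^ 2 + y ^ 2) := by
  have h : x + y ≤ 2 * max x y := by
    rw [two_mul]; exact add_le_add (le_max_left _ _) (le_max_right _ _)
  refine (pow_le_pow_left' h 2).trans ?_
  rw [mul_pow]
  refine mul_le_mul' (by norm_num) ?_
  rcases max_cases x y with ⟨h, -⟩ | ⟨h, -⟩ <;> rw [h]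
  · exact le_self_add
  · exact le_add_self

theorem tsum_mul_tsum {ι κ : Type*} (F : ι → ℝ≥0∞) (G : κ → ℝ≥0∞) :
    ∑' p : ι × κ, F p.1 * G p.2 = (∑' i, F i) * ∑' j, G j := by
  rw [ENNReal.tsum_prod (f := fun i j => F i * G j)]
  simp only [ENNReal.tsum_mul_left, ENNReal.tsum_mul_right]

/-- The kernel `q` defines a trilinear convolution form bounded by `√B` on `ℓ²`. -/
def TriBound (q : ℤ → ℤ → ℤ → ℝ≥0∞) (B : ℝ≥0∞) : Prop :=
  ∀ f g h : ℤ → ℝ≥0∞,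
    ∑' k, (∑' p : ℤ × ℤ, q p.1 p.2 (k - p.1 - p.2) * (f p.1 * g p.2 * h (k - p.1 - p.2))) ^ 2 ≤
      B * ((∑' k, f k ^ 2) * (∑' k, g k ^ 2) * ∑' k, h k ^ 2)

namespace TriBound

variable {q q' : ℤ → ℤ → ℤ → ℝ≥0∞} {B B' : ℝ≥0∞}

theorem mono (hq : TriBound q' B) (h : ∀ a b c, q a b c ≤ q' a b c) (hB : B ≤ B') :
    TriBound q B' := fun f g h' => by
  refine le_trans ?_ ((hq f g h').trans (mul_le_mul_left hB _))
  gcongr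
  exact h _ _ _

theorem add (hq : TriBound q B) (hq' : TriBound q' B) :
    TriBound (fun a b c => q a b c + q' a b c) (8 * B) := fun f g h => by
  simp only [add_mul, ENNReal.tsum_add]
  refine (ENNReal.tsum_le_tsum fun k => add_sq_le_four_mul _ _).trans ?_
  rw [ENNReal.tsum_mul_left, ENNReal.tsum_add]
  refine (mul_le_mul_right (add_le_add (hq f g h) (hq' f g h)) _).trans_eq ?_
  ring

theorem swap_left (hq : TriBound q B) : TriBound (fun a b c => q b a c) B := fun f g h => by
  have := hq g f h
  rw [mul_comm (∑' k, g k ^ 2)] at this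
  refine le_of_eq_of_le ?_ this
  refine tsum_congr fun k => ?_
  rw [← (Equiv.prodComm ℤ ℤ).tsum_eq]
  congr 1
  refine tsum_congr fun p => ?_
  simp only [Equiv.prodComm_apply, Prod.fst_swap, Prod.snd_swap]
  rw [mul_comm (f p.2), sub_right_comm]

/-- The exchange of the last two frequencies at fixed output frequency `k`. -/
def exchange (k : ℤ) : ℤ × ℤ ≃ ℤ × ℤ where
  toFun p := (p.1, k - p.1 - p.2)
  invFun p := (p.1, k - p.1 - p.2)
  left_inv p := by simp
  right_inv p := by simp

theorem swap_right (hq : TriBound q B) : TriBound (fun a b c => q a c b) B := fun f g h => by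
  have := hq f h g
  rw [mul_right_comm (∑' k, f k ^ 2)] at this
  refine le_of_eq_of_le ?_ this
  refine tsum_congr fun k => ?_
  rw [← (exchange k).tsum_eq]
  congr 1
  refine tsum_congr fun p => ?_
  simp only [exchange, Equiv.coe_fn_mk, sub_sub_cancel]
  ring

theorem of_pointwise
    (h : ∀ f g h : ℤ → ℝ≥0∞, ∃ w : ℤ → ℝ≥0∞, (∀ k, (∑' p : ℤ × ℤ,
      q p.1 p.2 (k - p.1 - p.2) * (f p.1 * g p.2 * h (k - p.1 - p.2))) ^ 2 ≤ w k) ∧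
      ∑' k, w k ≤ B * ((∑' k, f k ^ 2) * (∑' k, g k ^ 2) * ∑' k, h k ^ 2)) :
    TriBound q B := fun f g h' => by
  obtain ⟨w, h1, h2⟩ := h f g h'
  exact (ENNReal.tsum_le_tsum h1).trans h2

theorem tsum_sub_sub (G : ℤ → ℝ≥0∞) (a b : ℤ) : ∑' k, G (k - a - b) = ∑' k, G k := by
  simp only [sub_sub]
  exact (Equiv.subRight (a + b)).tsum_eq G

theorem tsum_mul_sub_sub (F G : ℤ → ℝ≥0∞) (k : ℤ) :
    ∑' p : ℤ × ℤ, F p.1 * G (k - p.1 - p.2) = (∑' a, F a) * ∑' c, G c := by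
  rw [← tsum_mul_tsum, ← (exchange k).tsum_eq]
  simp [exchange]

variable (r : ℤ → ℝ≥0∞)

/-- Cauchy–Schwarz in (k₁, k₂) separates r(k₁)r(k₂) from the product of the inputs; summing the
square of the latter over k factors it completely. -/
theorem input_input : TriBound (fun a b _ => r a * r b) ((∑' k, r k ^ 2) ^ 2) := by
  refine of_pointwise fun f g h => ⟨fun k => (∑' k, r k ^ 2) ^ 2 *
    ∑' p : ℤ × ℤ, (f p.1 * g p.2 * h (k - p.1 - p.2)) ^ 2, fun k => ?_, ?_⟩
  · refine (sq_tsum_mul_le (fun p : ℤ × ℤ => r p.1 * r p.2) _).trans_eq ?_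
    simp only [mul_pow]
    rw [tsum_mul_tsum (fun a => r a ^ 2) (fun a => r a ^ 2), sq]
  · rw [ENNReal.tsum_mul_left, ENNReal.tsum_comm]
    simp only [mul_pow, ENNReal.tsum_mul_left, tsum_sub_sub (fun k => h k ^ 2),
      ENNReal.tsum_mul_right]
    rw [tsum_mul_tsum (fun a => f a ^ 2) (fun a => g a ^ 2)]

/-- The factor r(k) leaves the inner sum and provides the summability in k. At fixed k,
Cauchy–Schwarz pairs r(k₁)g(k₂) with f(k₁)h(k₃), each square-summable over the pairs. -/
theorem output_input : TriBound (fun a b c => r (a + b + c) * r a) ((∑' k, r k ^ 2) ^ 2) := by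
  refine of_pointwise fun f g h => ⟨fun k => r k ^ 2 * ((∑' k, r k ^ 2) *
    ((∑' k, f k ^ 2) * (∑' k, g k ^ 2) * ∑' k, h k ^ 2)), fun k => ?_, ?_⟩
  · have e : ∀ p : ℤ × ℤ, r (p.1 + p.2 + (k - p.1 - p.2)) * r p.1 *
        (f p.1 * g p.2 * h (k - p.1 - p.2)) =
        r k * ((r p.1 * g p.2) * (f p.1 * h (k - p.1 - p.2))) := fun p => by
      rw [show p.1 + p.2 + (k - p.1 - p.2) = k by ring]; ring
    simp only [e, ENNReal.tsum_mul_left, mul_pow]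
    refine mul_le_mul_right ((sq_tsum_mul_le _ _).trans_eq ?_) _
    simp only [mul_pow]
    rw [tsum_mul_tsum (fun a => r a ^ 2) (fun a => g a ^ 2),
      tsum_mul_sub_sub (fun a => f a ^ 2) (fun a => h a ^ 2)]
    ring
  · rw [ENNReal.tsum_mul_right, ← mul_assoc, sq]

/-- As for one input, but with f(k₁)r(k₁+k₂) paired against g(k₂)h(k₃). -/
theorem output_pair : TriBound (fun a b c => r (a + b + c) * r (a + b)) ((∑' k, r k ^ 2) ^ 2) := by
  refine of_pointwise fun f g h => ⟨fun k => r k ^ 2 * ((∑' k, r k ^ 2) *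
    ((∑' k, f k ^ 2) * (∑' k, g k ^ 2) * ∑' k, h k ^ 2)), fun k => ?_, ?_⟩
  · have e : ∀ p : ℤ × ℤ, r (p.1 + p.2 + (k - p.1 - p.2)) * r (p.1 + p.2) *
        (f p.1 * g p.2 * h (k - p.1 - p.2)) =
        r k * ((f p.1 * r (p.1 + p.2)) * (g p.2 * h (k - p.2 - p.1))) := fun p => by
      rw [show p.1 + p.2 + (k - p.1 - p.2) = k by ring, sub_right_comm]; ring
    simp only [e, ENNReal.tsum_mul_left, mul_pow]
    refine mul_le_mul_right ((sq_tsum_mul_le _ _).trans_eq ?_) _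
    simp only [mul_pow]
    have h1 : ∑' p : ℤ × ℤ, f p.1 ^ 2 * r (p.1 + p.2) ^ 2 = (∑' k, f k ^ 2) * ∑' k, r k ^ 2 := by
      rw [ENNReal.tsum_prod (f := fun a b => f a ^ 2 * r (a + b) ^ 2)]
      simp only [ENNReal.tsum_mul_left, fun a => (Equiv.addLeft a).tsum_eq (fun b => r b ^ 2),
        ← Equiv.coe_addLeft, ENNReal.tsum_mul_right]
    rw [h1, ← (Equiv.prodComm ℤ ℤ).tsum_eq]
    simp only [Equiv.prodComm_apply, Prod.fst_swap, Prod.snd_swap]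
    rw [tsum_mul_sub_sub (fun a => g a ^ 2) (fun a => h a ^ 2)]
    ring
  · rw [ENNReal.tsum_mul_right, ← mul_assoc, sq]

/-- On k₁+k₂ = 0 the output is h(k) times the constant ∑ f(a)g(-a), so no decay is needed. -/
theorem resonance : TriBound (fun a b _ => if a + b = 0 then 1 else 0) 1 := by
  refine of_pointwise fun f g h => ⟨fun k => (∑' k, f k ^ 2) * (∑' k, g k ^ 2) * h k ^ 2,
    fun k => ?_, ?_⟩
  · have e : ∑' p : ℤ × ℤ, (if p.1 + p.2 = 0 then 1 else 0) *
        (f p.1 * g p.2 * h (k - p.1 - p.2)) = (∑' a, f a * g (-a)) * h k := by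
      rw [ENNReal.tsum_prod (f := fun a b => (if a + b = 0 then 1 else 0) *
        (f a * g b * h (k - a - b))), ← ENNReal.tsum_mul_right]
      refine tsum_congr fun a => ?_
      rw [tsum_eq_single (-a)]
      · simp
      · intro b hb
        rw [if_neg (fun h0 => hb (by omega)), zero_mul]
    rw [e, mul_pow]
    refine mul_le_mul_left ((sq_tsum_mul_le _ _).trans_eq ?_) _
    rw [← (Equiv.neg ℤ).tsum_eq (fun b => g b ^ 2)]
    rfl
  · rw [ENNReal.tsum_mul_left, one_mul]

/-- The trilinear form of the majorant is bounded on `ℓ²` by a multiple of `∑ r²`. -/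
theorem majorant {r : ℤ → ℝ} (hr : ∀ k, 0 < r k)
    (hS : 1 ≤ ∑' k, ENNReal.ofReal (r k) ^ 2) :
    TriBound (fun a b c => ENNReal.ofReal (HINLRI.majorant r a b c))
      (8 ^ 4 * (∑' k, ENNReal.ofReal (r k) ^ 2) ^ 2) := by
  set s : ℤ → ℝ≥0∞ := fun k => ENNReal.ofReal (r k) with hs
  set S := ∑' k, s k ^ 2
  have hS2 : (1 : ℝ≥0∞) ≤ S ^ 2 := one_le_pow₀ hS
  have A1 := input_input s
  have A2 := A1.swap_right
  have A3 := A2.swap_left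
  have B1 := output_input s
  have B2 := B1.swap_left
  have B3 := B2.swap_right
  have C1 := output_pair s
  have C2 := C1.swap_right
  have D1 := resonance.mono (fun _ _ _ => le_rfl) hS2
  have D2 := D1.swap_right
  have D3 := D2.swap_left
  have hB' : S ^ 2 ≤ 8 * S ^ 2 := le_mul_of_one_le_left' (by norm_num)
  -- A balanced sum following the bracketing of `majorant`: each level multiplies the constant by 8,
  -- and the shallower branches are padded up to 8^4.
  have T := (((A1.add A2).add (A3.add D3)).mono (fun _ _ _ => le_rfl)
      (mul_le_mul_right (le_mul_of_one_le_left' (by norm_num) : 8 * S ^ 2 ≤ 8 * (8 * S ^ 2)) 8)).add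
    (((B1.add B2).add (B3.add D1)).add ((C1.add C2).add (D2.mono (fun _ _ _ => le_rfl) hB')))
  refine T.mono (fun a b c => ?_) (le_of_eq (by ring))
  have m : ∀ x y, ENNReal.ofReal (r x * r y) = s x * s y := fun x y =>
    ENNReal.ofReal_mul (hr x).le
  have i : ∀ x : ℤ, ENNReal.ofReal (if x = 0 then 1 else 0) = if x = 0 then 1 else 0 := fun x => by
    split_ifs <;> simp
  unfold HINLRI.majorant
  refine le_of_le_of_eq ((ENNReal.ofReal_add_le).trans (add_le_add
    ((ENNReal.ofReal_add_le).trans (add_le_add ENNReal.ofReal_add_le ENNReal.ofReal_add_le))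
    ((ENNReal.ofReal_add_le).trans (add_le_add
      ((ENNReal.ofReal_add_le).trans (add_le_add ENNReal.ofReal_add_le ENNReal.ofReal_add_le))
      ((ENNReal.ofReal_add_le).trans (add_le_add ENNReal.ofReal_add_le le_rfl)))))) ?_
  simp only [m, i]
  rw [add_comm b a, add_right_comm a c b, show c + a + b = a + b + c by ring]

end TriBound

/-! ### Cubic interactions as operators on Sobolev spaces -/

theorem enorm_sq_lp (x : lp (fun _ : ℤ => ℂ) 2) : ‖x‖ₑ ^ 2 = ∑' k, ‖x k‖ₑ ^ 2 := by
  have h := lp.norm_rpow_eq_tsum (p := 2) (by norm_num) x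
  have hs := (lp.memℓp x).summable (p := 2) (by norm_num)
  simp only [ENNReal.toReal_ofNat, Real.rpow_two] at h hs
  rw [← ofReal_norm, ← ENNReal.ofReal_pow (norm_nonneg _), h,
    ENNReal.ofReal_tsum_of_nonneg (fun _ => by positivity) hs]
  refine tsum_congr fun k => ?_
  rw [ENNReal.ofReal_pow (norm_nonneg _), ofReal_norm]

theorem memℓp_two_of_tsum {F : ℤ → ℂ} (h : ∑' k, ‖F k‖ₑ ^ 2 ≠ ∞) : Memℓp F 2 := by
  refine memℓp_gen ?_
  simp only [ENNReal.toReal_ofNat, Real.rpow_two]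
  have h' : ∑' k, ((‖F k‖₊ ^ 2 : NNReal) : ℝ≥0∞) ≠ ∞ := by
    simp only [ENNReal.coe_pow]; exact h
  have := NNReal.summable_coe.mpr (ENNReal.tsum_coe_ne_top_iff_summable.mp h')
  simpa using this

theorem enorm_sq_L2 (f : L2) : ‖f‖ₑ ^ 2 = ∑' k, ‖coeff f k‖ₑ ^ 2 := by
  simp only [coeff_eq_repr]
  rw [← enorm_sq_lp, ← ofReal_norm, ← ofReal_norm, LinearIsometryEquiv.norm_map]

theorem coeff_sub (f g : L2) (k : ℤ) : coeff (f - g) k = coeff f k - coeff g k := by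
  simp [coeff_eq_repr]

theorem coeff_ofCoeff {F : ℤ → ℂ} (h : Memℓp F 2) (k : ℤ) : coeff (ofCoeff F) k = F k := by
  rw [coeff_eq_repr, ofCoeff, dif_pos h, LinearIsometryEquiv.apply_symm_apply]

theorem L2_ext {f g : L2} (h : ∀ k, coeff f k = coeff g k) : f = g := by
  apply (fourierBasis (T := 2 * Real.pi)).repr.injective
  ext k
  simpa [coeff_eq_repr] using h k

theorem Sobolev.hat_sub {γ : ℝ} (u v : Sobolev γ) (k : ℤ) : (u - v).hat k = u.hat k - v.hat k := by
  simp only [Sobolev.hat, map_sub, coeff_sub]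

theorem Sobolev.enorm_sq {γ : ℝ} (u : Sobolev γ) :
    ‖u‖ₑ ^ 2 = ∑' k, ‖(weight γ k : ℂ) * u.hat k‖ₑ ^ 2 := by
  have : ‖u‖ₑ = ‖Sobolev.weighted u‖ₑ := by
    rw [← ofReal_norm, ← ofReal_norm]; rfl
  rw [this, enorm_sq_lp]
  rfl

/-- The coefficient of `a(k₁) a(k₂) a(k₃)` in the cubic interaction. -/
def cubicCoeff (κ : ℝ → ℝ → ℂ) (tn τ : ℝ) (k : ℤ) (p : ℤ × ℤ) : ℂ :=
  -exp (I * (tn + τ) * (k : ℂ) ^ 3) *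
    ((18 * I * (k : ℂ))⁻¹ * exp (-(I * tn * phase p.1 p.2 (k - p.1 - p.2))) *
      κ (phaseOuter p.1 p.2 (k - p.1 - p.2)) (phaseInner p.2 (k - p.1 - p.2)))

theorem cubicTerm_eq (κ : ℝ → ℝ → ℂ) (tn τ : ℝ) (a : ℤ → ℂ) (k : ℤ) (p : ℤ × ℤ) :
    cubicTerm κ tn τ a k p =
      cubicCoeff κ tn τ k p * (a p.1 * a p.2 * a (k - p.1 - p.2)) := by
  simp only [cubicTerm, cubicCoeff]; ring

/-- The kernel `κ` is dominated by `A` times the majorant of `r` in `H^γ`. -/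
def KernelBound (γ : ℝ) (κ : ℝ → ℝ → ℂ) (r : ℤ → ℝ) (A : ℝ) : Prop :=
  ∀ k₁ k₂ k₃ : ℤ, k₁ + k₂ + k₃ ≠ 0 → ‖κ (phaseOuter k₁ k₂ k₃) (phaseInner k₂ k₃)‖ ≤
    A * |((k₁ + k₂ + k₃ : ℤ) : ℝ)| * (weight γ k₁ * weight γ k₂ * weight γ k₃) *
      majorant r k₁ k₂ k₃

/-- The cubic interaction with kernel `κ` is bounded by `M`, as an absolutely convergent trilinear
operator from `H^γ` to `L²`. -/
def CubicBound (γ : ℝ) (κ : ℝ → ℝ → ℂ) (tn τ M : ℝ) : Prop :=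
  ∀ u v w : Sobolev γ, ∑' k, (∑' p : ℤ × ℤ,
    ‖cubicCoeff κ tn τ k p * (u.hat p.1 * v.hat p.2 * w.hat (k - p.1 - p.2))‖ₑ) ^ 2 ≤
      ENNReal.ofReal (M * (‖u‖ * ‖v‖ * ‖w‖)) ^ 2

theorem majorant_nonneg {r : ℤ → ℝ} (hr : ∀ k, 0 < r k) (k₁ k₂ k₃ : ℤ) :
    0 ≤ majorant r k₁ k₂ k₃ := by
  simpa using mul_pair_le_majorant hr (k₁ := k₁) (k₂ := k₂) (k₃ := k₃) (E := 0) zero_le_one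
    (Or.inl (by have := hr k₁; have := hr k₂; positivity))

theorem norm_exp_I_mul_ofReal (x : ℝ) : ‖exp (I * x)‖ = 1 := by
  rw [mul_comm]; exact norm_exp_ofReal_mul_I x

theorem KernelBound.norm_cubicCoeff_le {γ : ℝ} {κ : ℝ → ℝ → ℂ} {r : ℤ → ℝ} {A : ℝ}
    (h : KernelBound γ κ r A) (hr : ∀ k, 0 < r k) (hA : 0 ≤ A) (tn τ : ℝ) (k : ℤ) (p : ℤ × ℤ) :
    ‖cubicCoeff κ tn τ k p‖ ≤
      A * (weight γ p.1 * weight γ p.2 * weight γ (k - p.1 - p.2)) *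
        majorant r p.1 p.2 (k - p.1 - p.2) := by
  have hm := majorant_nonneg hr p.1 p.2 (k - p.1 - p.2)
  have w1 := weight_pos γ p.1
  have w2 := weight_pos γ p.2
  have w3 := weight_pos γ (k - p.1 - p.2)
  rcases eq_or_ne k 0 with rfl | hk
  · simp only [cubicCoeff, Int.cast_zero, mul_zero, inv_zero, zero_mul, norm_zero]
    positivity
  have hs : p.1 + p.2 + (k - p.1 - p.2) = k := by ring
  have h1 := h p.1 p.2 (k - p.1 - p.2) (by rwa [hs])
  rw [hs] at h1
  have hkr : (1 : ℝ) ≤ |(k : ℝ)| := by exact_mod_cast Int.one_le_abs hk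
  have e1 : ‖exp (I * (tn + τ) * (k : ℂ) ^ 3)‖ = 1 := by
    rw [← norm_exp_I_mul_ofReal ((tn + τ) * (k : ℝ) ^ 3)]; push_cast; ring_nf
  have e2 : ‖exp (-(I * tn * phase p.1 p.2 (k - p.1 - p.2)))‖ = 1 := by
    rw [← norm_exp_I_mul_ofReal (-(tn * phase p.1 p.2 (k - p.1 - p.2)))]; push_cast; ring_nf
  have e3 : ‖(18 * I * (k : ℂ))⁻¹‖ = (18 * |(k : ℝ)|)⁻¹ := by
    rw [norm_inv]; simp
  rw [cubicCoeff, norm_mul, norm_neg, norm_mul, norm_mul, e1, e2, e3, one_mul, mul_one,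
    inv_mul_le_iff₀ (by positivity)]
  refine h1.trans ?_
  have : 0 ≤ A * (weight γ p.1 * weight γ p.2 * weight γ (k - p.1 - p.2)) *
    majorant r p.1 p.2 (k - p.1 - p.2) * |(k : ℝ)| := by positivity
  linarith

/-- The Sobolev weights pass from the kernel to the inputs, which leaves the ℓ² form of the
majorant. The factor 64 is the square root of 8^4. -/
theorem KernelBound.cubicBound {γ : ℝ} {κ : ℝ → ℝ → ℂ} {r : ℤ → ℝ} {A S : ℝ}
    (h : KernelBound γ κ r A) (hr : ∀ k, 0 < r k) (hA : 0 ≤ A)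
    (hS : ∑' k, ENNReal.ofReal (r k) ^ 2 = ENNReal.ofReal S) (hS1 : 1 ≤ S) (tn τ : ℝ) :
    CubicBound γ κ tn τ (64 * A * S) := by
  intro u v w
  have hT := TriBound.majorant hr (by rw [hS]; exact ENNReal.one_le_ofReal.mpr hS1)
    (fun k => ‖(weight γ k : ℂ) * u.hat k‖ₑ) (fun k => ‖(weight γ k : ℂ) * v.hat k‖ₑ)
    (fun k => ‖(weight γ k : ℂ) * w.hat k‖ₑ)
  rw [← u.enorm_sq, ← v.enorm_sq, ← w.enorm_sq, hS] at hT
  have hpt : ∀ k (p : ℤ × ℤ),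
      ‖cubicCoeff κ tn τ k p * (u.hat p.1 * v.hat p.2 * w.hat (k - p.1 - p.2))‖ₑ ≤
      ENNReal.ofReal A * (ENNReal.ofReal (majorant r p.1 p.2 (k - p.1 - p.2)) *
        (‖(weight γ p.1 : ℂ) * u.hat p.1‖ₑ * ‖(weight γ p.2 : ℂ) * v.hat p.2‖ₑ *
          ‖(weight γ (k - p.1 - p.2) : ℂ) * w.hat (k - p.1 - p.2)‖ₑ)) := by
    intro k p
    have hm := majorant_nonneg hr p.1 p.2 (k - p.1 - p.2)
    simp only [← ofReal_norm]
    rw [← ENNReal.ofReal_mul (by positivity), ← ENNReal.ofReal_mul (by positivity),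
      ← ENNReal.ofReal_mul (by positivity), ← ENNReal.ofReal_mul (by positivity)]
    apply ENNReal.ofReal_le_ofReal
    have hw : ∀ j, ‖(weight γ j : ℂ)‖ = weight γ j := fun j => by
      rw [Complex.norm_real, Real.norm_of_nonneg (weight_pos γ j).le]
    simp only [norm_mul, hw]
    refine (mul_le_mul_of_nonneg_right (h.norm_cubicCoeff_le hr hA tn τ k p)
      (by positivity)).trans_eq ?_
    ring
  calc _ ≤ ∑' k, (∑' p : ℤ × ℤ, ENNReal.ofReal A *
        (ENNReal.ofReal (majorant r p.1 p.2 (k - p.1 - p.2)) *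
        (‖(weight γ p.1 : ℂ) * u.hat p.1‖ₑ * ‖(weight γ p.2 : ℂ) * v.hat p.2‖ₑ *
          ‖(weight γ (k - p.1 - p.2) : ℂ) * w.hat (k - p.1 - p.2)‖ₑ))) ^ 2 := by
        gcongr with k p; exact hpt k p
    _ ≤ ENNReal.ofReal A ^ 2 * (8 ^ 4 * ENNReal.ofReal S ^ 2 * (‖u‖ₑ ^ 2 * ‖v‖ₑ ^ 2 * ‖w‖ₑ ^ 2)) := by
        simp only [ENNReal.tsum_mul_left, mul_pow] at hT ⊢
        gcongr
    _ = _ := by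
        rw [ENNReal.ofReal_mul (by positivity), ENNReal.ofReal_mul (by positivity),
          ENNReal.ofReal_mul (by positivity), ENNReal.ofReal_mul (by positivity),
          ENNReal.ofReal_mul (by positivity), ofReal_norm, ofReal_norm, ofReal_norm,
          ENNReal.ofReal_ofNat]
        ring

/-- The cubic interaction with kernel `κ`. -/
def cubicOp {γ : ℝ} (κ : ℝ → ℝ → ℂ) (tn τ : ℝ) (u : Sobolev γ) : L2 :=
  ofCoeff fun k => ∑' p : ℤ × ℤ, cubicTerm κ tn τ u.hat k p

namespace CubicBound

variable {γ : ℝ} {κ : ℝ → ℝ → ℂ} {tn τ M : ℝ}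

theorem summable (h : CubicBound γ κ tn τ M) (u v w : Sobolev γ) (k : ℤ) :
    Summable fun p : ℤ × ℤ =>
      cubicCoeff κ tn τ k p * (u.hat p.1 * v.hat p.2 * w.hat (k - p.1 - p.2)) := by
  have h1 := ENNReal.ne_top_of_tsum_ne_top
    (ne_top_of_le_ne_top (ENNReal.pow_ne_top ENNReal.ofReal_ne_top) (h u v w)) k
  exact Summable.of_nnnorm (ENNReal.tsum_coe_ne_top_iff_summable.mp
    ((ENNReal.pow_ne_top_iff.mp h1).resolve_right two_ne_zero))

theorem memℓp (h : CubicBound γ κ tn τ M) (u : Sobolev γ) :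
    Memℓp (fun k => ∑' p : ℤ × ℤ, cubicTerm κ tn τ u.hat k p) 2 := by
  refine memℓp_two_of_tsum (ne_top_of_le_ne_top
    (ENNReal.pow_ne_top ENNReal.ofReal_ne_top) (le_trans ?_ (h u u u)))
  gcongr with k
  simp only [cubicTerm_eq]
  exact enorm_tsum_le_tsum_enorm

theorem hasSum (h : CubicBound γ κ tn τ M) (u : Sobolev γ) (k : ℤ) :
    HasSum (cubicTerm κ tn τ u.hat k) (coeff (cubicOp κ tn τ u) k) := by
  rw [cubicOp, coeff_ofCoeff (h.memℓp u)]
  refine Summable.hasSum ?_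
  exact (h.summable u u u k).congr fun p => (cubicTerm_eq κ tn τ u.hat k p).symm

theorem norm_le (h : CubicBound γ κ tn τ M) (hM : 0 ≤ M) (u : Sobolev γ) :
    ‖cubicOp κ tn τ u‖ ≤ M * ‖u‖ ^ 3 := by
  have h1 : ‖cubicOp κ tn τ u‖ₑ ^ 2 ≤ ENNReal.ofReal (M * (‖u‖ * ‖u‖ * ‖u‖)) ^ 2 := by
    rw [enorm_sq_L2]
    refine le_trans ?_ (h u u u)
    gcongr with k
    rw [← (h.hasSum u k).tsum_eq]
    simp only [cubicTerm_eq]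
    exact enorm_tsum_le_tsum_enorm
  rw [← ofReal_norm, ← ENNReal.ofReal_pow (norm_nonneg _), ← ENNReal.ofReal_pow (by positivity),
    ENNReal.ofReal_le_ofReal_iff (by positivity)] at h1
  refine ((sq_le_sq₀ (norm_nonneg _) (by positivity)).mp h1).trans_eq (by ring)

/-- Trilinearity: uuu - vvv = duu + vdu + vvd with d = u - v, and the trilinear bound applies to
each term. -/
theorem norm_sub_le (h : CubicBound γ κ tn τ M) (hM : 0 ≤ M) (u v : Sobolev γ) :
    ‖cubicOp κ tn τ u - cubicOp κ tn τ v‖ ≤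
      4 * M * (‖u - v‖ * (‖u‖ * ‖u‖ + ‖v‖ * ‖u‖ + ‖v‖ * ‖v‖)) := by
  set d := u - v with hd
  have hcoef : ∀ k, ‖coeff (cubicOp κ tn τ u - cubicOp κ tn τ v) k‖ₑ ≤
      (∑' p : ℤ × ℤ, ‖cubicCoeff κ tn τ k p * (d.hat p.1 * u.hat p.2 * u.hat (k - p.1 - p.2))‖ₑ) +
      ((∑' p : ℤ × ℤ, ‖cubicCoeff κ tn τ k p * (v.hat p.1 * d.hat p.2 * u.hat (k - p.1 - p.2))‖ₑ) +
      ∑' p : ℤ × ℤ, ‖cubicCoeff κ tn τ k p * (v.hat p.1 * v.hat p.2 * d.hat (k - p.1 - p.2))‖ₑ) := by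
    intro k
    rw [coeff_sub, ← (h.hasSum u k).tsum_eq, ← (h.hasSum v k).tsum_eq,
      ← (h.hasSum u k).summable.tsum_sub (h.hasSum v k).summable]
    rw [← ENNReal.tsum_add, ← ENNReal.tsum_add]
    refine (enorm_tsum_le_tsum_enorm).trans (ENNReal.tsum_le_tsum fun p => ?_)
    have e : cubicTerm κ tn τ u.hat k p - cubicTerm κ tn τ v.hat k p =
        cubicCoeff κ tn τ k p * (d.hat p.1 * u.hat p.2 * u.hat (k - p.1 - p.2)) +
        (cubicCoeff κ tn τ k p * (v.hat p.1 * d.hat p.2 * u.hat (k - p.1 - p.2)) +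
        cubicCoeff κ tn τ k p * (v.hat p.1 * v.hat p.2 * d.hat (k - p.1 - p.2))) := by
      simp only [cubicTerm_eq, hd, Sobolev.hat_sub]; ring
    rw [e]
    exact (enorm_add_le _ _).trans (add_le_add_right (enorm_add_le _ _) _)
  have h1 : ‖cubicOp κ tn τ u - cubicOp κ tn τ v‖ₑ ^ 2 ≤
      4 * (ENNReal.ofReal (M * (‖d‖ * ‖u‖ * ‖u‖)) ^ 2 +
        4 * (ENNReal.ofReal (M * (‖v‖ * ‖d‖ * ‖u‖)) ^ 2 +
          ENNReal.ofReal (M * (‖v‖ * ‖v‖ * ‖d‖)) ^ 2)) := by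
    rw [enorm_sq_L2]
    refine (ENNReal.tsum_le_tsum fun k => (pow_le_pow_left' (hcoef k) 2).trans
      ((add_sq_le_four_mul _ _).trans (mul_le_mul_right (add_le_add_right
        (add_sq_le_four_mul _ _) _) _))).trans ?_
    rw [ENNReal.tsum_mul_left, ENNReal.tsum_add, ENNReal.tsum_mul_left, ENNReal.tsum_add]
    exact mul_le_mul_right (add_le_add (h d u u) (mul_le_mul_right
      (add_le_add (h v d u) (h v v d)) _)) _
  have h4 : (4 : ℝ≥0∞) = ENNReal.ofReal 4 := by simp
  rw [← ofReal_norm, ← ENNReal.ofReal_pow (norm_nonneg _), ← ENNReal.ofReal_pow (by positivity),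
    ← ENNReal.ofReal_pow (by positivity), ← ENNReal.ofReal_pow (by positivity), h4,
    ← ENNReal.ofReal_add (by positivity) (by positivity), ← ENNReal.ofReal_mul (by positivity),
    ← ENNReal.ofReal_add (by positivity) (by positivity), ← ENNReal.ofReal_mul (by positivity),
    ENNReal.ofReal_le_ofReal_iff (by positivity)] at h1
  refine (sq_le_sq₀ (norm_nonneg _) (by positivity)).mp (h1.trans ?_)
  have a1 : 0 ≤ M * (‖d‖ * ‖u‖ * ‖u‖) := by positivity
  have a2 : 0 ≤ M * (‖v‖ * ‖d‖ * ‖u‖) := by positivity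
  have a3 : 0 ≤ M * (‖v‖ * ‖v‖ * ‖d‖) := by positivity
  rw [show 4 * M * (‖d‖ * (‖u‖ * ‖u‖ + ‖v‖ * ‖u‖ + ‖v‖ * ‖v‖)) = 4 * (M * (‖d‖ * ‖u‖ * ‖u‖) +
    M * (‖v‖ * ‖d‖ * ‖u‖) + M * (‖v‖ * ‖v‖ * ‖d‖)) by ring]
  nlinarith [mul_nonneg a1 a2, mul_nonneg a1 a3, mul_nonneg a2 a3, sq_nonneg (M * (‖d‖ * ‖u‖ * ‖u‖))]

theorem continuous (h : CubicBound γ κ tn τ M) (hM : 0 ≤ M) :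
    Continuous (cubicOp κ tn τ : Sobolev γ → L2) := by
  refine continuous_iff_continuousAt.mpr fun v => ?_
  rw [ContinuousAt, tendsto_iff_norm_sub_tendsto_zero]
  refine squeeze_zero (fun u => norm_nonneg _) (fun u => h.norm_sub_le hM u v) ?_
  have : Continuous fun u : Sobolev γ =>
      4 * M * (‖u - v‖ * (‖u‖ * ‖u‖ + ‖v‖ * ‖u‖ + ‖v‖ * ‖v‖)) := by fun_prop
  simpa using this.tendsto v

end CubicBound

/-! ### Bounds for the oscillatory averages -/

theorem avg_integrand_eq (s φ : ℝ) : exp (-(I * s * φ)) = exp (I * ((-(s * φ) : ℝ) : ℂ)) := by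
  push_cast; ring_nf

theorem norm_avg_le_one {τ : ℝ} (hτ : 0 < τ) (φ : ℝ) : ‖avg τ φ‖ ≤ 1 := by
  have h := intervalIntegral.norm_integral_le_of_norm_le_const (a := 0) (b := τ) (C := 1)
    (f := fun s : ℝ => exp (-(I * s * φ))) (fun s _ => by
      rw [avg_integrand_eq, norm_exp_I_mul_ofReal])
  rw [avg, norm_mul, norm_inv, Complex.norm_real, Real.norm_of_nonneg hτ.le,
    inv_mul_le_iff₀ hτ]
  simpa [abs_of_pos hτ] using h

/-- The integral of the exponential is explicit: a difference of two unimodular numbers divided by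
φ. -/
theorem norm_avg_mul_le_two {τ : ℝ} (hτ : 0 < τ) (φ : ℝ) : ‖avg τ φ‖ * (τ * |φ|) ≤ 2 := by
  rcases eq_or_ne φ 0 with rfl | hφ
  · simp
  have hc : (-(I * φ) : ℂ) ≠ 0 := by simp [hφ]
  have h : ∫ s in (0 : ℝ)..τ, exp (-(I * s * φ)) = (exp (-(I * φ) * τ) - 1) / (-(I * φ)) := by
    have := integral_exp_mul_complex (a := 0) (b := τ) hc
    simp only [ofReal_zero, mul_zero, exp_zero] at this
    rw [← this]
    congr 1 with s
    ring_nf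
  have h2 : ‖exp (-(I * φ) * τ) - 1‖ ≤ 2 := by
    refine (norm_sub_le _ _).trans ?_
    rw [show (-(I * φ) * τ : ℂ) = I * ((-(φ * τ) : ℝ) : ℂ) by push_cast; ring,
      norm_exp_I_mul_ofReal, norm_one]
    norm_num
  have hφ' : 0 < |φ| := abs_pos.mpr hφ
  rw [avg, h, norm_mul, norm_inv, norm_div, Complex.norm_real, Real.norm_of_nonneg hτ.le, norm_neg,
    norm_mul, norm_I, Complex.norm_real, Real.norm_eq_abs, one_mul]
  rw [neg_mul] at h2 ⊢
  field_simp
  exact h2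

theorem norm_avg_add_sub_le {τ : ℝ} (hτ : 0 < τ) (x y : ℝ) :
    ‖avg τ (x + y) - avg τ y‖ ≤ τ * |x| := by
  have hint : ∀ z : ℝ, IntervalIntegrable (fun s : ℝ => exp (-(I * s * (z : ℂ)))) volume 0 τ :=
    fun z => (by fun_prop : Continuous fun s : ℝ => exp (-(I * s * (z : ℂ)))).intervalIntegrable _ _
  rw [avg, avg, ← mul_sub, ← intervalIntegral.integral_sub (hint _) (hint _), norm_mul, norm_inv,
    Complex.norm_real, Real.norm_of_nonneg hτ.le, inv_mul_le_iff₀ hτ]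
  have h := intervalIntegral.norm_integral_le_of_norm_le_const (a := 0) (b := τ) (C := τ * |x|)
    (f := fun s : ℝ => exp (-(I * s * ((x + y : ℝ) : ℂ))) - exp (-(I * s * (y : ℂ))))
    (fun s hs => by
      rw [Set.uIoc_of_le hτ.le] at hs
      have e : exp (-(I * s * ((x + y : ℝ) : ℂ))) - exp (-(I * s * (y : ℂ))) =
          (exp (I * ((-(s * x) : ℝ) : ℂ)) - 1) * exp (I * ((-(s * y) : ℝ) : ℂ)) := by
        rw [sub_mul, ← exp_add, one_mul]; push_cast; ring_nf
      rw [e, norm_mul, norm_exp_I_mul_ofReal, mul_one]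
      refine (Real.norm_exp_I_mul_ofReal_sub_one_le).trans ?_
      rw [Real.norm_eq_abs, abs_neg, abs_mul, abs_of_pos hs.1]
      exact mul_le_mul_of_nonneg_right hs.2 (abs_nonneg _))
  rw [sub_zero, abs_of_pos hτ] at h
  linarith

theorem avg_zero {τ : ℝ} (hτ : 0 < τ) : avg τ 0 = 1 := by
  have : (τ : ℂ) ≠ 0 := by exact_mod_cast hτ.ne'
  simp [avg, this]

theorem norm_mismatch_le_two {τ : ℝ} (hτ : 0 < τ) (x y : ℝ) : ‖mismatch τ x y‖ ≤ 2 := by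
  have h1 := norm_avg_le_one hτ (x + y)
  have h2 := mul_le_one₀ (norm_avg_le_one hτ x) (norm_nonneg _) (norm_avg_le_one hτ y)
  refine (norm_sub_le _ _).trans ?_
  rw [norm_mul]
  linarith

/-- At x = 0 the average of e^{-isx} is 1 and the two terms of the kernel coincide. Subtracting that
value leaves two differences, each bounded by τ|x|. -/
theorem norm_mismatch_le_left {τ : ℝ} (hτ : 0 < τ) (x y : ℝ) :
    ‖mismatch τ x y‖ ≤ 2 * (τ * |x|) := by
  have h1 := norm_avg_add_sub_le hτ x y
  have h2 := norm_avg_add_sub_le hτ x 0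
  rw [add_zero, avg_zero hτ] at h2
  have e : mismatch τ x y = (avg τ (x + y) - avg τ y) - (avg τ x - 1) * avg τ y := by
    rw [mismatch]; ring
  rw [e]
  refine (norm_sub_le _ _).trans ?_
  rw [norm_mul]
  have h3 := mul_le_mul h2 (norm_avg_le_one hτ y) (norm_nonneg _) (by positivity)
  linarith

theorem mismatch_comm (τ x y : ℝ) : mismatch τ x y = mismatch τ y x := by
  rw [mismatch, mismatch, add_comm, mul_comm]

/-- The coupled average contributes 2. For the product, |x+y| ≤ |x|+|y| lets each phase be absorbed
by its own average, contributing 2+2. -/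
theorem norm_mismatch_mul_le {τ : ℝ} (hτ : 0 < τ) (x y : ℝ) :
    ‖mismatch τ x y‖ * (τ * |x + y|) ≤ 6 := by
  have h1 := norm_avg_mul_le_two hτ (x + y)
  have h2 := mul_le_mul (norm_avg_mul_le_two hτ x) (norm_avg_le_one hτ y) (norm_nonneg _)
    (by norm_num)
  have h3 := mul_le_mul (norm_avg_mul_le_two hτ y) (norm_avg_le_one hτ x) (norm_nonneg _)
    (by norm_num)
  have h4 : ‖mismatch τ x y‖ ≤ ‖avg τ (x + y)‖ + ‖avg τ x‖ * ‖avg τ y‖ := by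
    rw [← norm_mul]; exact norm_sub_le _ _
  have h5 : ‖avg τ x‖ * ‖avg τ y‖ * (τ * |x + y|) ≤
      ‖avg τ x‖ * ‖avg τ y‖ * (τ * (|x| + |y|)) := by
    gcongr; exact abs_add_le _ _
  have h6 := mul_le_mul_of_nonneg_right h4 (by positivity : 0 ≤ τ * |x + y|)
  nlinarith

theorem abs_of_eq_three_mul {x y : ℝ} (h : x = 3 * y) : |x| = 3 * |y| := by
  rw [h, abs_mul, abs_of_pos (by norm_num : (0 : ℝ) < 3)]

theorem phaseOuter_eq (k₁ k₂ k₃ : ℤ) :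
    phaseOuter k₁ k₂ k₃ = 3 * (((k₁ : ℝ) + k₂ + k₃) * k₁ * (k₂ + k₃)) := by
  rw [phaseOuter]; ring

theorem phaseInner_eq (k₂ k₃ : ℤ) : phaseInner k₂ k₃ = 3 * ((k₂ : ℝ) * k₃ * (k₂ + k₃)) := by
  rw [phaseInner]; ring

/-- Dividing by 6 normalises all five bounds: it is the constant 2 of the first-order bounds times
the factor 3 common to the factored phases. -/
theorem mismatchBound {τ : ℝ} (hτ : 0 < τ) (k₁ k₂ k₃ : ℤ) :
    MismatchBound τ (‖mismatch τ (phaseOuter k₁ k₂ k₃) (phaseInner k₂ k₃)‖ / 6) k₁ k₂ k₃ where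
  nonneg := by positivity
  le_one := by linarith [norm_mismatch_le_two hτ (phaseOuter k₁ k₂ k₃) (phaseInner k₂ k₃)]
  le_outer := by
    have h := norm_mismatch_le_left hτ (phaseOuter k₁ k₂ k₃) (phaseInner k₂ k₃)
    rw [abs_of_eq_three_mul (phaseOuter_eq k₁ k₂ k₃)] at h
    linarith
  le_inner := by
    have h := norm_mismatch_le_left hτ (phaseInner k₂ k₃) (phaseOuter k₁ k₂ k₃)
    rw [mismatch_comm, abs_of_eq_three_mul (phaseInner_eq k₂ k₃)] at h
    linarith
  mul_le_one := by
    have h := norm_mismatch_mul_le hτ (phaseOuter k₁ k₂ k₃) (phaseInner k₂ k₃)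
    have e : phaseOuter k₁ k₂ k₃ + phaseInner k₂ k₃ =
        3 * (((k₂ : ℝ) + k₃) * (k₁ + k₃) * (k₁ + k₂)) := by
      rw [phaseOuter, phaseInner]; ring
    rw [abs_of_eq_three_mul e] at h
    linarith

/-! ### Kernel bounds -/

theorem one_le_weight {γ : ℝ} (hγ : 0 ≤ γ) (k : ℤ) : 1 ≤ weight γ k :=
  Real.one_le_rpow (by nlinarith [sq_nonneg (k : ℝ)]) (by linarith)

theorem abs_rpow_le_weight {γ : ℝ} (hγ : 0 ≤ γ) (k : ℤ) : |(k : ℝ)| ^ γ ≤ weight γ k := by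
  have : |(k : ℝ)| ^ γ = ((k : ℝ) ^ 2) ^ (γ / 2) := by
    rw [← sq_abs, ← Real.rpow_natCast, ← Real.rpow_mul (abs_nonneg _)]
    congr 1; push_cast; ring
  rw [this]
  exact Real.rpow_le_rpow (sq_nonneg _) (by linarith) (by linarith)

theorem kernelBound_mismatch {γ δ τ : ℝ} (hγ1 : γ ≤ 1) (hδ : 0 ≤ δ) (hδγ : δ ≤ γ) (hτ : 0 < τ)
    (hτ1 : τ ≤ 1) :
    KernelBound γ (fun x y => (τ : ℂ) * mismatch τ x y) (decay δ)
      (6 * 20 ^ 10 * (τ * τ ^ (γ - δ))) := by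
  intro k₁ k₂ k₃ hk
  have h := (mismatchBound hτ k₁ k₂ k₃).le_majorant (g := γ - δ) hτ hτ1 (by linarith) hδ
    (by linarith) hk
  have hm := majorant_nonneg (decay_pos δ) k₁ k₂ k₃
  have ht := Real.rpow_pos_of_pos hτ (γ - δ)
  have hs : kernelScale τ (γ - δ) δ k₁ k₂ k₃ ≤ 20 ^ 10 * τ ^ (γ - δ) *
      |((k₁ + k₂ + k₃ : ℤ) : ℝ)| * (weight γ k₁ * weight γ k₂ * weight γ k₃) := by
    have h0 : 0 ≤ γ := hδ.trans hδγ
    rw [kernelScale, sub_add_cancel]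
    have p := fun k => (weight_pos γ k).le
    gcongr <;> first | exact abs_rpow_le_weight h0 _ | exact mul_nonneg (p _) (p _) | exact p _
  have h2 := mul_le_mul_of_nonneg_right hs hm
  rw [norm_mul, Complex.norm_real, Real.norm_of_nonneg hτ.le]
  have h3 := mul_le_mul_of_nonneg_left (h.trans h2) (by positivity : 0 ≤ 6 * τ)
  linarith

theorem inv_abs_le_decay {δ : ℝ} (hδ1 : δ ≤ 1) {k : ℤ} (hk : k ≠ 0) :
    |(k : ℝ)|⁻¹ ≤ decay δ k := by
  have h1 : (1 : ℝ) ≤ |(k : ℝ)| := by exact_mod_cast Int.one_le_abs hk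
  rw [decay, max_eq_right h1, ← Real.rpow_neg_one]
  exact Real.rpow_le_rpow_of_exponent_le h1 (by linarith)

theorem decay_zero (δ : ℝ) : decay δ 0 = 1 := by simp [decay]

theorem norm_avg_le_decay {δ τ φ c : ℝ} (hδ1 : δ ≤ 1) (hτ : 0 < τ) {a b : ℤ} (ha : a ≠ 0)
    (hb : b ≠ 0) (hc : 1 ≤ c) (hφ : |φ| = 3 * (c * (|(a : ℝ)| * |(b : ℝ)|))) :
    ‖avg τ φ‖ ≤ τ⁻¹ * (decay δ a * decay δ b) := by
  have ha' : (0 : ℝ) < |(a : ℝ)| := by positivity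
  have hb' : (0 : ℝ) < |(b : ℝ)| := by positivity
  have h := norm_avg_mul_le_two hτ φ
  rw [hφ] at h
  have h1 : ‖avg τ φ‖ * (τ * (|(a : ℝ)| * |(b : ℝ)|)) ≤ 1 := by
    have h3 : ‖avg τ φ‖ * (τ * (|(a : ℝ)| * |(b : ℝ)|)) ≤
        ‖avg τ φ‖ * (τ * (c * (|(a : ℝ)| * |(b : ℝ)|))) :=
      mul_le_mul_of_nonneg_left (mul_le_mul_of_nonneg_left
        (le_mul_of_one_le_left (by positivity) hc) hτ.le) (norm_nonneg _)
    nlinarith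
  have h2 : ‖avg τ φ‖ ≤ τ⁻¹ * (|(a : ℝ)|⁻¹ * |(b : ℝ)|⁻¹) := by
    rw [← mul_inv, ← mul_inv, ← one_div, le_div_iff₀ (by positivity)]
    exact h1
  refine h2.trans ?_
  gcongr
  · exact (decay_pos δ a).le
  · exact inv_abs_le_decay hδ1 ha
  · exact inv_abs_le_decay hδ1 hb

theorem norm_avg_outer_le_decay {δ τ φ : ℝ} (hδ1 : δ ≤ 1) (hτ : 0 < τ) {a b : ℤ} (hb : b ≠ 0)
    (hab : a + b ≠ 0) (hφ : |φ| = 3 * (|((a + b : ℤ) : ℝ)| * (|(a : ℝ)| * |(b : ℝ)|))) :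
    ‖avg τ φ‖ ≤ (1 + τ⁻¹) * |((a + b : ℤ) : ℝ)| * (decay δ a * decay δ b) := by
  have h1 : (1 : ℝ) ≤ |((a + b : ℤ) : ℝ)| := by exact_mod_cast Int.one_le_abs hab
  have hd : 0 ≤ decay δ a * decay δ b := mul_nonneg (decay_pos _ _).le (decay_pos _ _).le
  have hτ' : 0 < τ⁻¹ := inv_pos.mpr hτ
  -- For a = 0 the phase vanishes and the average gives nothing; the factor |a+b| = |b| compensates
  -- for the decay at b.
  rcases eq_or_ne a 0 with rfl | ha
  · have h2 := inv_abs_le_decay hδ1 hb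
    have hb' : (0 : ℝ) < |(b : ℝ)| := by positivity
    rw [inv_le_iff_one_le_mul₀ hb'] at h2
    simp only [zero_add, decay_zero, one_mul] at h1 ⊢
    refine (norm_avg_le_one hτ φ).trans ?_
    have : 0 ≤ τ⁻¹ * (decay δ b * |(b : ℝ)|) := by linarith [mul_le_mul_of_nonneg_left h2 hτ'.le]
    linarith
  · refine (norm_avg_le_decay hδ1 hτ ha hb h1 hφ).trans ?_
    refine mul_le_mul_of_nonneg_right ?_ hd
    nlinarith

/-- The defect is a difference of two elements of L², each defined as 0 if its coefficients are not
square-summable, so the integrator's own series has to converge separately. Only finiteness matters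
here; the constant is not uniform in the gain of τ. -/
theorem kernelBound_lri {γ δ τ : ℝ} (hγ : 0 ≤ γ) (hδ1 : δ ≤ 1) (hτ : 0 < τ) :
    KernelBound γ (fun x y => (τ : ℂ) * (avg τ x * avg τ y)) (decay δ) (τ * (1 + τ⁻¹)) := by
  intro k₁ k₂ k₃ hk
  have hk1 : (1 : ℝ) ≤ |((k₁ + k₂ + k₃ : ℤ) : ℝ)| := by exact_mod_cast Int.one_le_abs hk
  have hm := majorant_nonneg (decay_pos δ) k₁ k₂ k₃
  have hτ' : 0 < τ⁻¹ := inv_pos.mpr hτ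
  have hX : |phaseOuter k₁ k₂ k₃| =
      3 * (|((k₁ + k₂ + k₃ : ℤ) : ℝ)| * (|(k₁ : ℝ)| * |((k₂ + k₃ : ℤ) : ℝ)|)) := by
    rw [abs_of_eq_three_mul (phaseOuter_eq k₁ k₂ k₃), abs_mul, abs_mul]; push_cast; ring
  have hY : |phaseInner k₂ k₃| =
      3 * (|((k₂ + k₃ : ℤ) : ℝ)| * (|(k₂ : ℝ)| * |(k₃ : ℝ)|)) := by
    rw [abs_of_eq_three_mul (phaseInner_eq k₂ k₃), abs_mul, abs_mul]; push_cast; ring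
  set X := phaseOuter k₁ k₂ k₃
  set Y := phaseInner k₂ k₃
  set c := (1 + τ⁻¹) * |((k₁ + k₂ + k₃ : ℤ) : ℝ)| with hcdef
  have hc0 : 0 ≤ c := by positivity
  have hc1 : 1 ≤ c := by nlinarith
  have hcτ : τ⁻¹ ≤ c := by nlinarith
  have hprodX : ‖avg τ X‖ * ‖avg τ Y‖ ≤ ‖avg τ X‖ :=
    mul_le_of_le_one_right (norm_nonneg _) (norm_avg_le_one hτ Y)
  have hprodY : ‖avg τ X‖ * ‖avg τ Y‖ ≤ ‖avg τ Y‖ :=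
    mul_le_of_le_one_left (norm_nonneg _) (norm_avg_le_one hτ X)
  have main : ‖avg τ X‖ * ‖avg τ Y‖ ≤ c * majorant (decay δ) k₁ k₂ k₃ := by
    apply mul_pair_le_majorant (decay_pos δ) hc0
    by_cases hn : k₂ + k₃ = 0
    · right; right; right; right; right; right; right; right; right; right
      exact ⟨hn, (hprodX.trans (norm_avg_le_one hτ X)).trans hc1⟩
    have hn1 : (1 : ℝ) ≤ |((k₂ + k₃ : ℤ) : ℝ)| := by exact_mod_cast Int.one_le_abs hn
    have houter : ‖avg τ X‖ ≤ c * (decay δ k₁ * decay δ (k₂ + k₃)) := by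
      have := norm_avg_outer_le_decay (φ := X) hδ1 hτ (a := k₁) hn (by rwa [← add_assoc])
        (by rw [hX, add_assoc])
      rwa [← add_assoc] at this
    by_cases h2 : k₂ = 0
    · right; left
      subst h2
      rw [zero_add] at houter
      exact hprodX.trans houter
    by_cases h3 : k₃ = 0
    · left
      subst h3
      rw [add_zero] at houter
      exact hprodX.trans houter
    · right; right; left
      refine hprodY.trans ((norm_avg_le_decay hδ1 hτ h2 h3 hn1 hY).trans ?_)
      exact mul_le_mul_of_nonneg_right hcτ (mul_nonneg (decay_pos _ _).le (decay_pos _ _).le)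
  rw [norm_mul, Complex.norm_real, Real.norm_of_nonneg hτ.le, norm_mul]
  have hw : 1 ≤ weight γ k₁ * weight γ k₂ * weight γ k₃ :=
    one_le_mul_of_one_le_of_one_le (one_le_mul_of_one_le_of_one_le (one_le_weight hγ _)
      (one_le_weight hγ _)) (one_le_weight hγ _)
  have h5 := mul_le_mul_of_nonneg_left main hτ.le
  have h6 := le_mul_of_one_le_right (by positivity : 0 ≤ τ * (c * majorant (decay δ) k₁ k₂ k₃)) hw
  calc _ ≤ _ := h5.trans h6
    _ = _ := by rw [hcdef]; ring

/-! ### Summability of the squared decay weight -/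

/-- Comparison with ∫ x^(-1-δ) dx, as a telescoping induction: log(n+2) - log(n+1) ≥ 1/(n+2) makes
the decrease of δ⁻¹x^(-δ) dominate the next summand. What matters is the explicit growth like 1/δ.
-/
theorem sum_range_rpow_le {δ : ℝ} (hδ : 0 < δ) (n : ℕ) :
    ∑ j ∈ Finset.range (n + 1), ((j : ℝ) + 1) ^ (-(1 + δ)) ≤
      1 + δ⁻¹ - δ⁻¹ * ((n : ℝ) + 1) ^ (-δ) := by
  induction n with
  | zero => simp
  | succ n ih =>
    rw [Finset.sum_range_succ]
    have hx : (0 : ℝ) < (n : ℝ) + 1 := by positivity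
    have hy : (0 : ℝ) < (n : ℝ) + 1 + 1 := by positivity
    have key : ((n : ℝ) + 1 + 1) ^ (-δ) * (1 + δ * ((n : ℝ) + 1 + 1)⁻¹) ≤ ((n : ℝ) + 1) ^ (-δ) := by
      rw [Real.rpow_def_of_pos hy, Real.rpow_def_of_pos hx]
      have h1 : Real.log ((n : ℝ) + 1) ≤ Real.log ((n : ℝ) + 1 + 1) - ((n : ℝ) + 1 + 1)⁻¹ := by
        have h2 := Real.log_le_sub_one_of_pos (div_pos hx hy)
        rw [Real.log_div hx.ne' hy.ne'] at h2
        have h3 : ((n : ℝ) + 1) / ((n : ℝ) + 1 + 1) - 1 = -((n : ℝ) + 1 + 1)⁻¹ := by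
          field_simp; ring
        linarith
      calc _ ≤ Real.exp (Real.log ((n : ℝ) + 1 + 1) * -δ) *
            Real.exp (δ * ((n : ℝ) + 1 + 1)⁻¹) := by
            gcongr
            linarith [Real.add_one_le_exp (δ * ((n : ℝ) + 1 + 1)⁻¹)]
        _ = Real.exp (Real.log ((n : ℝ) + 1 + 1) * -δ + δ * ((n : ℝ) + 1 + 1)⁻¹) := by
            rw [Real.exp_add]
        _ ≤ _ := Real.exp_le_exp.mpr (by nlinarith)
    have e : ((n : ℝ) + 1 + 1) ^ (-(1 + δ)) =
        ((n : ℝ) + 1 + 1) ^ (-δ) * ((n : ℝ) + 1 + 1)⁻¹ := by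
      rw [← Real.rpow_neg_one ((n : ℝ) + 1 + 1), ← Real.rpow_add hy]; congr 1; ring
    push_cast
    rw [e]
    have h4 := mul_le_mul_of_nonneg_left key (inv_nonneg.mpr hδ.le)
    have h5 : δ⁻¹ * (((n : ℝ) + 1 + 1) ^ (-δ) * (1 + δ * ((n : ℝ) + 1 + 1)⁻¹)) =
        δ⁻¹ * ((n : ℝ) + 1 + 1) ^ (-δ) + ((n : ℝ) + 1 + 1) ^ (-δ) * ((n : ℝ) + 1 + 1)⁻¹ := by
      field_simp
    linarith

theorem hasSum_decay_sq {δ : ℝ} (hδ : 0 < δ) (hδ1 : δ ≤ 1) :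
    ∃ S, 1 ≤ S ∧ S ≤ 5 / δ ∧ ∑' k, ENNReal.ofReal (decay δ k) ^ 2 = ENNReal.ofReal S := by
  have hnn : ∀ j : ℕ, 0 ≤ ((j : ℝ) + 1) ^ (-(1 + δ)) := fun j => by positivity
  have hle : ∀ n, ∑ j ∈ Finset.range n, ((j : ℝ) + 1) ^ (-(1 + δ)) ≤ 1 + δ⁻¹ := fun n => by
    refine (Finset.sum_le_sum_of_subset_of_nonneg (Finset.range_mono n.le_succ)
      fun _ _ _ => hnn _).trans ((sum_range_rpow_le hδ n).trans ?_)
    have : 0 ≤ δ⁻¹ * ((n : ℝ) + 1) ^ (-δ) := by positivity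
    linarith
  have hsum := summable_of_sum_range_le hnn hle
  have hZ := Real.tsum_le_of_sum_range_le hnn hle
  have hZ0 : 0 ≤ ∑' j : ℕ, ((j : ℝ) + 1) ^ (-(1 + δ)) := tsum_nonneg hnn
  have hsq : ∀ k : ℤ, decay δ k ^ 2 = (max 1 |(k : ℝ)|) ^ (-(1 + δ)) := fun k => by
    rw [decay, ← Real.rpow_natCast, ← Real.rpow_mul (by positivity)]
    congr 1; push_cast; ring
  have hpos : ∀ j : ℕ, decay δ ((j : ℤ) + 1) ^ 2 = ((j : ℝ) + 1) ^ (-(1 + δ)) := fun j => by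
    have h0 : (0 : ℝ) ≤ j := by positivity
    rw [hsq]; push_cast
    rw [abs_of_nonneg (by linarith), max_eq_right (by linarith)]
  have hneg : ∀ j : ℕ, decay δ (-((j : ℤ) + 1)) ^ 2 = ((j : ℝ) + 1) ^ (-(1 + δ)) := fun j => by
    rw [← hpos, hsq, hsq]; push_cast
    rw [abs_neg]
  have h1 : HasSum (fun n : ℕ => decay δ (n : ℤ) ^ 2)
      (1 + ∑' j : ℕ, ((j : ℝ) + 1) ^ (-(1 + δ))) := by
    have : HasSum (fun n : ℕ => decay δ ((n + 1 : ℕ) : ℤ) ^ 2)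
        (∑' j : ℕ, ((j : ℝ) + 1) ^ (-(1 + δ))) := by
      simpa only [Nat.cast_add, Nat.cast_one, hpos] using hsum.hasSum
    have h2 := (hasSum_nat_add_iff (f := fun n : ℕ => decay δ (n : ℤ) ^ 2) 1).mp this
    simpa [decay_zero, add_comm] using h2
  have h2 : HasSum (fun n : ℕ => decay δ (-((n : ℤ) + 1)) ^ 2)
      (∑' j : ℕ, ((j : ℝ) + 1) ^ (-(1 + δ))) := by
    simpa only [hneg] using hsum.hasSum
  have h3 := HasSum.of_nat_of_neg_add_one (f := fun k : ℤ => decay δ k ^ 2) h1 h2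
  refine ⟨1 + ∑' j : ℕ, ((j : ℝ) + 1) ^ (-(1 + δ)) + ∑' j : ℕ, ((j : ℝ) + 1) ^ (-(1 + δ)),
    by linarith, ?_, ?_⟩
  rotate_left
  · rw [← h3.tsum_eq, ENNReal.ofReal_tsum_of_nonneg (fun k => by positivity) h3.summable]
    exact tsum_congr fun k => (ENNReal.ofReal_pow (decay_pos δ k).le 2).symm
  -- The sum is 1+2Z with Z ≤ 1+1/δ, hence at most 3+2/δ ≤ 5/δ.
  · have : 1 ≤ δ⁻¹ := (one_le_inv₀ hδ).mpr hδ1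
    rw [div_eq_mul_inv]
    linarith

/-! ### The local error bound of the unfiltered integrator -/

theorem KernelBound.add {γ : ℝ} {κ κ' : ℝ → ℝ → ℂ} {r : ℤ → ℝ} {A A' : ℝ}
    (h : KernelBound γ κ r A) (h' : KernelBound γ κ' r A') :
    KernelBound γ (fun x y => κ x y + κ' x y) r (A + A') := by
  intro k₁ k₂ k₃ hk
  refine (norm_add_le _ _).trans ((add_le_add (h k₁ k₂ k₃ hk) (h' k₁ k₂ k₃ hk)).trans_eq ?_)
  ring

theorem integral_exp_eq {τ : ℝ} (hτ : 0 < τ) (x y : ℝ) :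
    ∫ s in (0 : ℝ)..τ, exp (-(I * s * ((x + y : ℝ) : ℂ))) =
      (τ : ℂ) * mismatch τ x y + (τ : ℂ) * (avg τ x * avg τ y) := by
  have : (τ : ℂ) ≠ 0 := by exact_mod_cast hτ.ne'
  rw [mismatch, ← mul_add, sub_add_cancel, avg, mul_inv_cancel_left₀ this]

/-- The constant of the local error bound of the unfiltered integrator. -/
def defectConst (γ τ₀ : ℝ) : ℝ :=
  64 * (6 * 20 ^ 10) * Real.exp (γ * Real.log (1 / τ₀)) * (5 / (γ * Real.log (1 / τ₀)))

theorem defectConst_pos {γ τ₀ : ℝ} (hγ : 0 < γ) (hτ₀ : 0 < τ₀) (hτ₁ : τ₀ < 1) :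
    0 < defectConst γ τ₀ := by
  have : 0 < Real.log (1 / τ₀) := Real.log_pos ((one_lt_div hτ₀).mpr hτ₁)
  unfold defectConst
  positivity

theorem log_inv_mono {τ τ₀ : ℝ} (hτ : 0 < τ) (h : τ ≤ τ₀) :
    Real.log (1 / τ₀) ≤ Real.log (1 / τ) :=
  Real.log_le_log (by have := hτ.trans_le h; positivity) (one_div_le_one_div_of_le hτ h)

theorem exists_cubicBound_defect {γ τ₀ τ : ℝ} (hγ : 0 < γ) (hγ1 : γ ≤ 1) (hτ₁ : τ₀ < 1)
    (hτ : 0 < τ) (hττ₀ : τ ≤ τ₀) (tn : ℝ) :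
    ∃ M, 0 ≤ M ∧ M ≤ defectConst γ τ₀ * τ ^ (1 + γ) * Real.log (1 / τ) ∧
      CubicBound γ (fun x y => (τ : ℂ) * mismatch τ x y) tn τ M ∧
      ∀ u : Sobolev γ, defect tn τ u = cubicOp (fun x y => (τ : ℂ) * mismatch τ x y) tn τ u := by
  have hτ₀ : 0 < τ₀ := hτ.trans_le hττ₀
  have hL₀ : 0 < Real.log (1 / τ₀) := Real.log_pos ((one_lt_div hτ₀).mpr hτ₁)
  have hL := log_inv_mono hτ hττ₀
  have hdef : defectConst γ τ₀ = 64 * (6 * 20 ^ 10) * Real.exp (γ * Real.log (1 / τ₀)) *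
    (5 / (γ * Real.log (1 / τ₀))) := rfl
  have hexp : Real.log τ = -Real.log (1 / τ) := by simp
  set L₀ := Real.log (1 / τ₀)
  set L := Real.log (1 / τ)
  have hLpos : 0 < L := hL₀.trans_le hL
  -- With L = ln(1/τ) and L₀ = ln(1/τ₀) this gives τ^(-δ) = e^(γL₀), independent of τ, while 5/δ =
  -- 5L/(γL₀) is the logarithmic factor. Also δ ≤ γ because L₀ ≤ L.
  set δ := γ * L₀ / L with hδdef
  have hδ : 0 < δ := by positivity
  have hδγ : δ ≤ γ := by rw [hδdef, div_le_iff₀ hLpos]; gcongr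
  have hδ1 : δ ≤ 1 := hδγ.trans hγ1
  obtain ⟨S, hS1, hS5, hS⟩ := hasSum_decay_sq hδ hδ1
  have hK := kernelBound_mismatch hγ1 hδ.le hδγ hτ (hττ₀.trans hτ₁.le)
  have hK' := kernelBound_lri hγ.le hδ1 hτ
  have hτδ := Real.rpow_pos_of_pos hτ (γ - δ)
  have hB := hK.cubicBound (decay_pos δ) (by positivity) hS hS1 tn τ
  have hB' := hK'.cubicBound (decay_pos δ) (by positivity) hS hS1 tn τ
  -- The exact kernel is the mismatch plus the integrator's kernel, so its series converges too and
  -- the two may be subtracted termwise.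
  have hB'' := (hK.add hK').cubicBound (decay_pos δ) (by positivity) hS hS1 tn τ
  refine ⟨_, by positivity, ?_, hB, fun u => L2_ext fun k => ?_⟩
  · have e1 : τ ^ (γ - δ) = τ ^ γ * Real.exp (γ * L₀) := by
      rw [Real.rpow_sub hτ, Real.rpow_def_of_pos hτ δ, hexp, div_eq_mul_inv, ← Real.exp_neg,
        neg_mul, neg_neg, hδdef, mul_div_cancel₀ _ hLpos.ne']
    have e2 : τ ^ (1 + γ) = τ * τ ^ γ := by rw [Real.rpow_add hτ, Real.rpow_one]
    have e3 : 5 / δ = 5 / (γ * L₀) * L := by rw [hδdef]; field_simp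
    calc 64 * (6 * 20 ^ 10 * (τ * τ ^ (γ - δ))) * S
        ≤ 64 * (6 * 20 ^ 10 * (τ * τ ^ (γ - δ))) * (5 / δ) := by gcongr
      _ = _ := by rw [e1, e2, e3, hdef]; ring
  · have h1 : exactIntegral tn τ u.hat = cubicOp (fun x y =>
        (τ : ℂ) * mismatch τ x y + (τ : ℂ) * (avg τ x * avg τ y)) tn τ u := by
      simp only [exactIntegral, cubicOp, integral_exp_eq hτ]
    have h2 : lriIntegral tn τ u.hat = cubicOp (fun x y =>
        (τ : ℂ) * (avg τ x * avg τ y)) tn τ u := rfl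
    rw [defect, coeff_sub, h1, h2]
    refine HasSum.unique ?_ (hB.hasSum u k)
    refine ((hB''.hasSum u k).sub (hB'.hasSum u k)).congr_fun fun p => ?_
    simp only [cubicTerm]; ring

/-! ### Density of networks with one hidden layer -/

section Density

open Filter Topology

/-- Modulo a closed subspace the integrand is zero, and the quotient map commutes with the integral.
-/
theorem integral_mem_of_isClosed {α E : Type*} [MeasurableSpace α] {μ : Measure α}
    [NormedAddCommGroup E] [NormedSpace ℝ E] [CompleteSpace E] {V : Submodule ℝ E}
    (hV : IsClosed (V : Set E)) {F : α → E} (hF : Integrable F μ) (h : ∀ t, F t ∈ V) :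
    ∫ t, F t ∂μ ∈ V := by
  have hV' : IsClosed (V : Set E) := hV
  have h1 := V.mkQL.integral_comp_comm hF
  have h2 : ∀ t, V.mkQL (F t) = 0 := fun t => (Submodule.Quotient.mk_eq_zero V).mpr (h t)
  simp only [h2, integral_zero] at h1
  exact (Submodule.Quotient.mk_eq_zero V).mp h1.symm

/-- The polynomial functions on `ℝ` of degree less than `n`. -/
def polyFun (n : ℕ) : Submodule ℝ (ℝ → ℝ) :=
  Submodule.span ℝ (Set.range fun (i : Fin n) (x : ℝ) => x ^ (i : ℕ))

/-- The topology on `ℝ → ℝ` is that of pointwise convergence: pointwise limits of polynomials of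
bounded degree are again such polynomials. -/
theorem isClosed_polyFun (n : ℕ) : IsClosed (polyFun n : Set (ℝ → ℝ)) := by
  have : FiniteDimensional ℝ (polyFun n) := FiniteDimensional.span_of_finite ℝ (Set.finite_range _)
  exact Submodule.closed_of_finiteDimensional _

theorem pow_mem_polyFun {n i : ℕ} (h : i < n) : (fun x : ℝ => x ^ i) ∈ polyFun n :=
  Submodule.subset_span ⟨⟨i, h⟩, rfl⟩

theorem exists_polynomial_of_mem_polyFun {n : ℕ} {f : ℝ → ℝ} (h : f ∈ polyFun n) :
    ∃ p : Polynomial ℝ, ∀ x, f x = p.eval x := by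
  induction h using Submodule.span_induction with
  | mem f hf =>
    obtain ⟨i, rfl⟩ := hf
    exact ⟨Polynomial.X ^ (i : ℕ), by simp⟩
  | zero => exact ⟨0, by simp⟩
  | add f g _ _ hf hg =>
    obtain ⟨p, hp⟩ := hf
    obtain ⟨q, hq⟩ := hg
    exact ⟨p + q, fun x => by simp [hp, hq]⟩
  | smul c f _ hf =>
    obtain ⟨p, hp⟩ := hf
    exact ⟨c • p, fun x => by simp [hp]⟩

theorem exists_antideriv_mem_polyFun {n : ℕ} {f : ℝ → ℝ} (h : f ∈ polyFun n) :
    ∃ F ∈ polyFun (n + 1), ∀ x, HasDerivAt F (f x) x := by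
  induction h using Submodule.span_induction with
  | mem f hf =>
    obtain ⟨i, rfl⟩ := hf
    refine ⟨((i : ℝ) + 1)⁻¹ • fun x => x ^ ((i : ℕ) + 1),
      Submodule.smul_mem _ _ (pow_mem_polyFun (by omega)), fun x => ?_⟩
    have := (hasDerivAt_pow ((i : ℕ) + 1) x).const_smul ((i : ℝ) + 1)⁻¹
    refine this.congr_deriv ?_
    have h0 : ((i : ℕ) : ℝ) + 1 ≠ 0 := by positivity
    simp only [smul_eq_mul, Nat.cast_add, Nat.cast_one, Nat.add_sub_cancel]
    rw [inv_mul_cancel_left₀ h0]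
  | zero => exact ⟨0, zero_mem _, fun x => hasDerivAt_const x 0⟩
  | add f g _ _ hf hg =>
    obtain ⟨F, hF, hF'⟩ := hf
    obtain ⟨G, hG, hG'⟩ := hg
    exact ⟨F + G, add_mem hF hG, fun x => (hF' x).add (hG' x)⟩
  | smul c f _ hf =>
    obtain ⟨F, hF, hF'⟩ := hf
    exact ⟨c • F, Submodule.smul_mem _ _ hF, fun x => (hF' x).const_smul c⟩

theorem mem_polyFun_of_iteratedDeriv_eq_zero (n : ℕ) :
    ∀ f : ℝ → ℝ, ContDiff ℝ (⊤ : ℕ∞) f → (∀ x, iteratedDeriv n f x = 0) → f ∈ polyFun n := by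
  induction n with
  | zero =>
    intro f _ h
    have : f = 0 := funext fun x => by simpa using h x
    exact this ▸ zero_mem _
  | succ n ih =>
    intro f hf h
    obtain ⟨hd, hf'⟩ := contDiff_infty_iff_deriv.mp hf
    obtain ⟨F, hF, hF'⟩ := exists_antideriv_mem_polyFun
      (ih (deriv f) hf' (by simpa only [iteratedDeriv_succ'] using h))
    have hc := is_const_of_deriv_eq_zero (f := fun x => f x - F x)
      (hd.sub fun x => (hF' x).differentiableAt)
      (fun x => by rw [((hd x).hasDerivAt.fun_sub (hF' x)).deriv, sub_self])
    have e : f = F + (f 0 - F 0) • fun x : ℝ => x ^ 0 := by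
      ext x
      have := hc x 0
      simp only [Pi.add_apply, Pi.smul_apply, pow_zero, smul_eq_mul, mul_one]
      linarith
    rw [e]
    exact add_mem hF (Submodule.smul_mem _ _ (pow_mem_polyFun (by omega)))

/-- A continuous function that is not a polynomial has, for every `n`, a mollification whose
`n`-th derivative does not vanish identically. -/
theorem exists_mollification {σ : ℝ → ℝ} (hσ : Continuous σ)
    (hpoly : ¬ ∃ p : Polynomial ℝ, ∀ x, σ x = p.eval x) (n : ℕ) :
    ∃ (φ : ContDiffBump (0 : ℝ)) (b : ℝ), iteratedDeriv n
      (convolution (φ.normed volume) σ (ContinuousLinearMap.lsmul ℝ ℝ) volume) b ≠ 0 := by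
  by_contra! hcon
  have hsmooth : ∀ φ : ContDiffBump (0 : ℝ), ContDiff ℝ (⊤ : ℕ∞)
      (convolution (φ.normed volume) σ (ContinuousLinearMap.lsmul ℝ ℝ) volume) := fun φ =>
    φ.hasCompactSupport_normed.contDiff_convolution_left _ φ.contDiff_normed
      hσ.locallyIntegrable
  -- Were the n-th derivatives of all mollifications zero, these would be polynomials of degree less
  -- than the same n, and so would be their pointwise limit σ as the supports shrink.
  let φ : ℕ → ContDiffBump (0 : ℝ) := fun i =>
    ⟨1 / ((i : ℝ) + 1) / 2, 1 / ((i : ℝ) + 1), by positivity, half_lt_self (by positivity)⟩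
  have hφ : Tendsto (fun i => (φ i).rOut) atTop (𝓝 0) := tendsto_one_div_add_atTop_nhds_zero_nat
  refine hpoly (exists_polynomial_of_mem_polyFun (n := n)
    ((isClosed_polyFun n).mem_of_tendsto (b := atTop) (tendsto_pi_nhds.mpr fun x =>
      ContDiffBump.convolution_tendsto_right_of_continuous (μ := volume) hφ hσ x)
      (Eventually.of_forall fun i => ?_)))
  exact mem_polyFun_of_iteratedDeriv_eq_zero n _ (hsmooth _) (hcon _)

variable {X : Type*} [TopologicalSpace X]

/-- The function `g(a ℓ + b)` on `X`. -/
def ridge (g : C(ℝ, ℝ)) (ℓ : C(X, ℝ)) (a b : ℝ) : C(X, ℝ) :=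
  g.comp (a • ℓ + ContinuousMap.const X b)

@[simp]
theorem ridge_apply (g : C(ℝ, ℝ)) (ℓ : C(X, ℝ)) (a b : ℝ) (x : X) :
    ridge g ℓ a b x = g (a * ℓ x + b) := rfl

theorem continuous_ridge (g : C(ℝ, ℝ)) (P ℓ : C(X, ℝ)) {a b : ℝ → ℝ} (ha : Continuous a)
    (hb : Continuous b) : Continuous fun t => P * ridge g ℓ (a t) (b t) := by
  refine ContinuousMap.continuous_of_continuous_uncurry _ ?_
  simp only [Function.uncurry_def, ContinuousMap.mul_apply, ridge_apply]
  fun_prop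

variable [CompactSpace X]

/-- Mollifying σ averages its ridge functions over translates of the bias, an integral in C(X) of
elements of the closed subspace. -/
theorem ridge_convolution_mem {V : Submodule ℝ C(X, ℝ)} (hV : IsClosed (V : Set C(X, ℝ)))
    {σ : C(ℝ, ℝ)} {ℓ : C(X, ℝ)} (h : ∀ a b, ridge σ ℓ a b ∈ V) (φ : ContDiffBump (0 : ℝ))
    (g : C(ℝ, ℝ)) (hg : ⇑g = convolution (φ.normed volume) σ (ContinuousLinearMap.lsmul ℝ ℝ) volume)
    (a b : ℝ) : ridge g ℓ a b ∈ V := by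
  set F : ℝ → C(X, ℝ) := fun t => φ.normed volume t • ridge σ ℓ a (b - t) with hF
  have hFc : Continuous F := by
    have h1 := continuous_ridge σ 1 ℓ (a := fun _ => a) (b := fun t => b - t) (by fun_prop)
      (by fun_prop)
    simp only [one_mul] at h1
    exact (φ.contDiff_normed (n := 0)).continuous.smul h1
  have hFi : Integrable F volume := hFc.integrable_of_hasCompactSupport
    φ.hasCompactSupport_normed.smul_right
  have hint := integral_mem_of_isClosed hV hFi fun t => V.smul_mem _ (h a (b - t))
  convert hint using 1
  ext x
  rw [ContinuousMap.integral_apply hFi, ridge_apply, hg, convolution_def]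
  refine integral_congr_ae (Eventually.of_forall fun t => ?_)
  simp [hF, add_sub_assoc]

/-- Differentiation in the slope stays in a closed subspace. -/
theorem mul_ridge_deriv_mem {V : Submodule ℝ C(X, ℝ)} (hV : IsClosed (V : Set C(X, ℝ)))
    {g g' : C(ℝ, ℝ)} (hg : ∀ x, HasDerivAt g (g' x) x) {P ℓ : C(X, ℝ)}
    (h : ∀ a b, P * ridge g ℓ a b ∈ V) (a b : ℝ) : P * ℓ * ridge g' ℓ a b ∈ V := by
  set F : ℝ → C(X, ℝ) := fun s => P * ℓ * ridge g' ℓ s b with hF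
  have hFc : Continuous F := continuous_ridge g' (P * ℓ) ℓ continuous_id continuous_const
  have hFi : ∀ c d : ℝ, IntervalIntegrable F volume c d := fun c d => hFc.intervalIntegrable c d
  -- Writing the family as an integral of a continuous C(X)-valued function makes the derivative in
  -- the slope hold in the uniform norm, not just pointwise.
  have key : ∀ s, P * ridge g ℓ s b = P * ridge g ℓ 0 b + ∫ t in (0 : ℝ)..s, F t := by
    intro s
    ext x
    have hx : (∫ t in (0 : ℝ)..s, F t) x = ∫ t in (0 : ℝ)..s, F t x := by
      rw [intervalIntegral, intervalIntegral, ContinuousMap.sub_apply,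
        ContinuousMap.integral_apply (hFi 0 s).1, ContinuousMap.integral_apply (hFi 0 s).2]
    have hder : ∀ t ∈ Set.uIcc (0 : ℝ) s,
        HasDerivAt (fun t => P x * g (t * ℓ x + b)) (F t x) t := by
      intro t _
      have h1 : HasDerivAt (fun t : ℝ => t * ℓ x + b) (ℓ x) t := by
        simpa using ((hasDerivAt_id t).mul_const (ℓ x)).add_const b
      have h2 := ((hg (t * ℓ x + b)).comp t h1).const_mul (P x)
      refine h2.congr_deriv ?_
      simp only [hF, ContinuousMap.mul_apply, ridge_apply]
      ring
    have hFx : Continuous fun t => F t x := (continuous_eval_const x).comp hFc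
    rw [ContinuousMap.add_apply, hx,
      intervalIntegral.integral_eq_sub_of_hasDerivAt hder (hFx.intervalIntegrable _ _)]
    simp
  have hder : HasDerivAt (fun s => P * ridge g ℓ s b) (F a) a := by
    rw [funext key]
    exact (intervalIntegral.integral_hasDerivAt_right (hFi 0 a)
      (hFc.stronglyMeasurableAtFilter _ _) hFc.continuousAt).const_add _
  rw [hasDerivAt_iff_tendsto_slope] at hder
  refine hV.mem_of_tendsto hder (Eventually.of_forall fun s => ?_)
  exact V.smul_mem _ (V.sub_mem (h s b) (h a b))

theorem pow_mul_ridge_iteratedDeriv_mem {V : Submodule ℝ C(X, ℝ)}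
    (hV : IsClosed (V : Set C(X, ℝ))) {f : ℝ → ℝ} (hf : ContDiff ℝ (⊤ : ℕ∞) f) {ℓ : C(X, ℝ)}
    (h : ∀ a b, ridge ⟨f, hf.continuous⟩ ℓ a b ∈ V) (n : ℕ) :
    ∀ a b, ℓ ^ n * ridge ⟨iteratedDeriv n f, hf.continuous_iteratedDeriv n (by exact_mod_cast le_top)⟩ ℓ a b ∈ V := by
  induction n with
  | zero => simpa [iteratedDeriv_zero] using h
  | succ n ih =>
    intro a b
    rw [pow_succ]
    refine mul_ridge_deriv_mem hV (fun x => ?_) ih a b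
    have := (hf.differentiable_iteratedDeriv n (by exact_mod_cast ENat.natCast_lt_top n)) x
    simpa [iteratedDeriv_succ] using this.hasDerivAt

/-- The n-th derivative in the slope at slope 0 is ℓ^n times the n-th derivative of the mollified σ
at b, a constant that can be chosen nonzero because σ is not a polynomial. -/
theorem pow_mem_of_ridge_mem {V : Submodule ℝ C(X, ℝ)} (hV : IsClosed (V : Set C(X, ℝ)))
    {σ : C(ℝ, ℝ)} (hpoly : ¬ ∃ p : Polynomial ℝ, ∀ x, σ x = p.eval x) {ℓ : C(X, ℝ)}
    (h : ∀ a b, ridge σ ℓ a b ∈ V) (n : ℕ) : ℓ ^ n ∈ V := by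
  obtain ⟨φ, b, hb⟩ := exists_mollification σ.continuous hpoly n
  have hs : ContDiff ℝ (⊤ : ℕ∞)
      (convolution (φ.normed volume) σ (ContinuousLinearMap.lsmul ℝ ℝ) volume) :=
    φ.hasCompactSupport_normed.contDiff_convolution_left _ φ.contDiff_normed
      σ.continuous.locallyIntegrable
  have h1 := pow_mul_ridge_iteratedDeriv_mem hV hs
    (ridge_convolution_mem hV h φ ⟨_, hs.continuous⟩ rfl) n 0 b
  have h2 := V.smul_mem (iteratedDeriv n
      (convolution (φ.normed volume) σ (ContinuousLinearMap.lsmul ℝ ℝ) volume) b)⁻¹ h1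
  convert h2 using 1
  ext x
  simp only [ContinuousMap.smul_apply, ContinuousMap.mul_apply, ridge_apply, zero_mul, zero_add,
    ContinuousMap.coe_mk, smul_eq_mul]
  field_simp

theorem exp_mem_of_pow_mem {V : Submodule ℝ C(X, ℝ)} (hV : IsClosed (V : Set C(X, ℝ)))
    {ℓ : C(X, ℝ)} (h : ∀ n : ℕ, ℓ ^ n ∈ V) : NormedSpace.exp ℓ ∈ V := by
  have hs := NormedSpace.exp_series_hasSum_exp' (𝕂 := ℝ) ℓ
  exact hV.mem_of_tendsto hs (Eventually.of_forall fun s =>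
    V.sum_mem fun n _ => V.smul_mem _ (h n))

theorem exp_apply (ℓ : C(X, ℝ)) (x : X) : NormedSpace.exp ℓ x = Real.exp (ℓ x) := by
  have h1 := (NormedSpace.exp_series_hasSum_exp' (𝕂 := ℝ) ℓ).map
    (ContinuousMap.evalCLM ℝ x) (ContinuousMap.evalCLM ℝ x).continuous
  have h2 := NormedSpace.exp_series_hasSum_exp' (𝕂 := ℝ) (ℓ x)
  rw [Real.exp_eq_exp_ℝ]
  exact h1.unique h2

/-- **Universal approximation.** On a compact space, the functions `σ(ℓ + b)`, with `ℓ` in a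
subspace separating the points, span a dense subspace if `σ` is continuous and not a polynomial. -/
theorem dense_span_activation {σ : C(ℝ, ℝ)}
    (hpoly : ¬ ∃ p : Polynomial ℝ, ∀ x, σ x = p.eval x) (Λ : Submodule ℝ C(X, ℝ))
    (hsep : ∀ x y : X, x ≠ y → ∃ ℓ ∈ Λ, ℓ x ≠ ℓ y) :
    (Submodule.span ℝ {f | ∃ ℓ ∈ Λ, ∃ b, f = σ.comp (ℓ + ContinuousMap.const X b)}).topologicalClosure
      = ⊤ := by
  set V := (Submodule.span ℝ
    {f | ∃ ℓ ∈ Λ, ∃ b, f = σ.comp (ℓ + ContinuousMap.const X b)}).topologicalClosure with hVdef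
  have hV : IsClosed (V : Set C(X, ℝ)) := Submodule.isClosed_topologicalClosure _
  have hexp : ∀ ℓ ∈ Λ, NormedSpace.exp ℓ ∈ V := fun ℓ hℓ =>
    exp_mem_of_pow_mem hV (pow_mem_of_ridge_mem hV hpoly fun a b =>
      Submodule.le_topologicalClosure _ (Submodule.subset_span ⟨a • ℓ, Λ.smul_mem a hℓ, b, rfl⟩))
  -- The exponentials of elements of Λ are closed under multiplication, so the algebra they generate
  -- is merely their linear span and stays inside V.
  let S : Submonoid C(X, ℝ) :=
    { carrier := {f | ∃ ℓ ∈ Λ, f = NormedSpace.exp ℓ}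
      one_mem' := ⟨0, Λ.zero_mem, by simp⟩
      mul_mem' := by
        rintro _ _ ⟨ℓ, hℓ, rfl⟩ ⟨m, hm, rfl⟩
        exact ⟨ℓ + m, Λ.add_mem hℓ hm, by ext x; simp [exp_apply, Real.exp_add]⟩ }
  have hA : (Algebra.adjoin ℝ (S : Set C(X, ℝ))).topologicalClosure = ⊤ := by
    refine ContinuousMap.subalgebra_topologicalClosure_eq_top_of_separatesPoints _ fun x y hxy => ?_
    obtain ⟨ℓ, hℓ, hne⟩ := hsep x y hxy
    refine ⟨_, ⟨NormedSpace.exp ℓ, Algebra.subset_adjoin ⟨ℓ, hℓ, rfl⟩, rfl⟩, ?_⟩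
    simpa [exp_apply] using hne
  have hle : Subalgebra.toSubmodule (Algebra.adjoin ℝ (S : Set C(X, ℝ))) ≤ V := by
    rw [Algebra.adjoin_eq_span, Submonoid.closure_eq, Submodule.span_le]
    rintro _ ⟨ℓ, hℓ, rfl⟩
    exact hexp ℓ hℓ
  refine eq_top_iff.mpr fun f _ => ?_
  have hf : f ∈ (Algebra.adjoin ℝ (S : Set C(X, ℝ))).topologicalClosure := by rw [hA]; trivial
  exact closure_minimal hle hV hf

end Density

/-! ### Approximation of operators by neural correctors -/

section Networks

open Filter Topology

/-- The functions of the input that are linear combinations of hidden units. -/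
def unitSpan (σ : ℝ → ℝ) (m : ℕ) : Submodule ℝ ((Fin m → ℝ) → ℝ) :=
  Submodule.span ℝ (Set.range fun (p : (Fin m → ℝ) × ℝ) (x : Fin m → ℝ) => σ (p.1 ⬝ᵥ x + p.2))

/-- One hidden layer suffices: its units are all those occurring in any of the outputs, and the
output layer stores the coefficients. -/
theorem exists_mlp_eval_eq {σ : ℝ → ℝ} {m n : ℕ} (F : Fin n → (Fin m → ℝ) → ℝ)
    (hF : ∀ i, F i ∈ unitSpan σ m) : ∃ N : MLP m n, ∀ x i, N.eval σ x i = F i x := by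
  classical
  have h1 : ∀ i, ∃ c : (Fin m → ℝ) × ℝ →₀ ℝ,
      (c.sum fun p a => a • fun x : Fin m → ℝ => σ (p.1 ⬝ᵥ x + p.2)) = F i := fun i =>
    Finsupp.mem_span_range_iff_exists_finsupp.mp (hF i)
  choose c hc using h1
  let T : Finset ((Fin m → ℝ) × ℝ) := Finset.univ.biUnion fun i => (c i).support
  let P : Fin T.card → (Fin m → ℝ) × ℝ := fun j => (T.equivFin.symm j : (Fin m → ℝ) × ℝ)
  refine ⟨.hidden (Matrix.of fun j => (P j).1) (fun j => (P j).2)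
    (.output (Matrix.of fun i j => c i (P j)) 0), fun x i => ?_⟩
  have hsub : (c i).support ⊆ T := Finset.subset_biUnion_of_mem (fun i => (c i).support)
    (Finset.mem_univ i)
  rw [← hc i, Finsupp.sum_of_support_subset _ hsub _ (by simp), Finset.sum_apply,
    ← Finset.sum_coe_sort T, ← T.equivFin.symm.sum_comp]
  simp [MLP.eval, Matrix.mulVec, dotProduct, P]

/-- The exponentials `e^{ikx}`, `k ∈ S`, as a trunk basis. -/
def fourierTrunk (S : Finset ℤ) (j : Fin S.card) : L2 :=
  fourierBasis (T := 2 * Real.pi) (S.equivFin.symm j : ℤ)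

theorem orthonormal_fourierTrunk (S : Finset ℤ) : Orthonormal ℂ (fourierTrunk S) :=
  (fourierBasis (T := 2 * Real.pi)).orthonormal.comp (fun j => (S.equivFin.symm j : ℤ))
    (Subtype.val_injective.comp S.equivFin.symm.injective)

/-- The input of the network of a corrector with trunk `e^{ikx}`, `k ∈ S`. -/
def latentInput (S : Finset ℤ) (τ : ℝ) (f : L2) : Fin (S.card + S.card + 1) → ℝ :=
  Fin.append (Fin.append (fun j => (coeff f (S.equivFin.symm j : ℤ)).re)
    (fun j => (coeff f (S.equivFin.symm j : ℤ)).im)) (fun _ : Fin 1 => τ)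

theorem coeff_eq_inner (f : L2) (k : ℤ) :
    coeff f k = inner ℂ (fourierBasis (T := 2 * Real.pi) k) f := by
  rw [coeff_eq_repr, HilbertBasis.repr_apply_apply]

theorem continuous_coeff (k : ℤ) : Continuous fun f : L2 => coeff f k := by
  simp only [coeff_eq_inner]
  fun_prop

/-- Any family of networks in the hidden units realises a corrector with a Fourier trunk. -/
theorem exists_corrector {σ : ℝ → ℝ} (τ : ℝ) (S : Finset ℤ)
    (A B : ℤ → (Fin (S.card + S.card + 1) → ℝ) → ℝ)
    (hA : ∀ k, A k ∈ unitSpan σ _) (hB : ∀ k, B k ∈ unitSpan σ _) :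
    ∃ N : NeuralCorrector, ∀ f : L2, N.correction σ τ f =
      ∑ k ∈ S, ((A k (latentInput S τ f) : ℂ) + (B k (latentInput S τ f) : ℂ) * I) •
        (fourierBasis (T := 2 * Real.pi) k : L2) := by
  obtain ⟨net, hnet⟩ := exists_mlp_eval_eq (σ := σ) (m := S.card + S.card + 1)
    (Fin.append (fun j : Fin S.card => A (S.equivFin.symm j : ℤ))
      (fun j : Fin S.card => B (S.equivFin.symm j : ℤ)))
    (fun i => by
      refine Fin.addCases (fun j => ?_) (fun j => ?_) i
      · rw [Fin.append_left]; exact hA _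
      · rw [Fin.append_right]; exact hB _)
  refine ⟨⟨S.card, fourierTrunk S, orthonormal_fourierTrunk S, net⟩, fun f => ?_⟩
  rw [← Finset.sum_coe_sort S, ← S.equivFin.symm.sum_comp]
  simp only [NeuralCorrector.correction, NeuralCorrector.prolong]
  refine Finset.sum_congr rfl fun j _ => ?_
  have hin : (Fin.append (Fin.append (fun j => ((inner ℂ (fourierTrunk S j) f : ℂ)).re)
      (fun j => ((inner ℂ (fourierTrunk S j) f : ℂ)).im)) (fun _ : Fin 1 => τ)) =
      latentInput S τ f := by
    simp only [latentInput, coeff_eq_inner]; rfl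
  simp only [NeuralCorrector.latent, NeuralCorrector.restrict]
  rw [hin, hnet, hnet, Fin.append_left, Fin.append_right]
  rfl

/-- The `S`-th partial Fourier sum. -/
def partialSum (S : Finset ℤ) (f : L2) : L2 :=
  ∑ k ∈ S, coeff f k • (fourierBasis (T := 2 * Real.pi) k : L2)

theorem continuous_partialSum (S : Finset ℤ) : Continuous (partialSum S) :=
  continuous_finsetSum _ fun k _ => (continuous_coeff k).smul continuous_const

theorem coeff_partialSum (S : Finset ℤ) (f : L2) (k : ℤ) :
    coeff (partialSum S f) k = if k ∈ S then coeff f k else 0 := by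
  classical
  rw [coeff_eq_inner, partialSum, inner_sum]
  simp only [inner_smul_right,
    orthonormal_iff_ite.mp (fourierBasis (T := 2 * Real.pi)).orthonormal]
  simp

theorem norm_sub_partialSum_anti (f : L2) {S T : Finset ℤ} (h : S ⊆ T) :
    ‖f - partialSum T f‖ ≤ ‖f - partialSum S f‖ := by
  have h1 : ‖f - partialSum T f‖ₑ ^ 2 ≤ ‖f - partialSum S f‖ₑ ^ 2 := by
    rw [enorm_sq_L2, enorm_sq_L2]
    gcongr with k
    rw [coeff_sub, coeff_sub, coeff_partialSum, coeff_partialSum]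
    by_cases hS : k ∈ S
    · simp [hS, h hS]
    · by_cases hT : k ∈ T <;> simp [hS, hT]
  have h2 := (ENNReal.pow_le_pow_left_iff two_ne_zero).mp h1
  rwa [← ofReal_norm, ← ofReal_norm, ENNReal.ofReal_le_ofReal_iff (norm_nonneg _)] at h2

/-- Enlarging S only decreases the tail, so the open sets of functions with small tail form a
directed cover of the compact set, and one of them contains it. -/
theorem exists_partialSum_near {Q : Set L2} (hQ : IsCompact Q) {ε : ℝ} (hε : 0 < ε) :
    ∃ S : Finset ℤ, ∀ f ∈ Q, ‖f - partialSum S f‖ < ε := by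
  obtain ⟨S, hS⟩ := hQ.elim_directed_cover (fun S : Finset ℤ => {f | ‖f - partialSum S f‖ < ε})
    (fun S => isOpen_lt (continuous_id.sub (continuous_partialSum S)).norm continuous_const)
    (fun f _ => by
      have h := (fourierBasis (T := 2 * Real.pi)).hasSum_repr f
      have h1 := Metric.tendsto_nhds.mp h ε hε
      obtain ⟨S, hS⟩ := h1.exists
      refine Set.mem_iUnion.mpr ⟨S, ?_⟩
      rw [dist_comm, dist_eq_norm] at hS
      simpa [partialSum, coeff_eq_repr] using hS)
    (fun S T => ⟨S ∪ T, fun f hf => (norm_sub_partialSum_anti f Finset.subset_union_left).trans_lt hf,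
      fun f hf => (norm_sub_partialSum_anti f Finset.subset_union_right).trans_lt hf⟩)
  exact ⟨S, hS⟩

/-! ### Fourier coefficients as continuous functions on subsets of the Sobolev space. -/

theorem Sobolev.norm_hat_le {γ : ℝ} (u : Sobolev γ) (k : ℤ) :
    ‖u.hat k‖ ≤ (weight γ k)⁻¹ * ‖u‖ := by
  have h := lp.norm_apply_le_norm (p := 2) two_ne_zero (Sobolev.weighted u) k
  have h' : ‖(weight γ k : ℂ) * u.hat k‖ ≤ ‖u‖ := h
  rw [norm_mul, Complex.norm_real, Real.norm_of_nonneg (weight_pos γ k).le] at h'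
  rwa [← div_eq_inv_mul, le_div_iff₀' (weight_pos γ k)]

theorem Sobolev.continuous_hat {γ : ℝ} (k : ℤ) : Continuous fun u : Sobolev γ => u.hat k := by
  refine (LipschitzWith.of_dist_le_mul (K := ⟨(weight γ k)⁻¹, (inv_pos.mpr (weight_pos γ k)).le⟩)
    fun u v => ?_).continuous
  rw [dist_eq_norm, dist_eq_norm, ← Sobolev.hat_sub]
  exact Sobolev.norm_hat_le _ _

theorem Sobolev.exists_hat_ne {γ : ℝ} {u v : Sobolev γ} (h : u ≠ v) : ∃ k, u.hat k ≠ v.hat k := by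
  by_contra! hcon
  exact h (Subtype.ext (L2_ext hcon))

section Functionals

variable {γ : ℝ} {K : Set (Sobolev γ)}

/-- The real part of a Fourier coefficient, as a function on `K`. -/
def reHat (K : Set (Sobolev γ)) (k : ℤ) : C(K, ℝ) :=
  ⟨fun u => (u.1.hat k).re, continuous_re.comp ((Sobolev.continuous_hat k).comp continuous_subtype_val)⟩

/-- The imaginary part of a Fourier coefficient, as a function on `K`. -/
def imHat (K : Set (Sobolev γ)) (k : ℤ) : C(K, ℝ) :=
  ⟨fun u => (u.1.hat k).im, continuous_im.comp ((Sobolev.continuous_hat k).comp continuous_subtype_val)⟩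

/-- The real-linear functionals of finitely many Fourier coefficients, as functions on `K`. -/
def functionals (K : Set (Sobolev γ)) : Submodule ℝ C(K, ℝ) :=
  Submodule.span ℝ (Set.range (reHat K) ∪ Set.range (imHat K))

theorem functionals_separate {u v : K} (h : u ≠ v) : ∃ ℓ ∈ functionals K, ℓ u ≠ ℓ v := by
  obtain ⟨k, hk⟩ := Sobolev.exists_hat_ne (fun h' => h (Subtype.ext h'))
  by_cases hre : (u.1.hat k).re = (v.1.hat k).re
  · refine ⟨imHat K k, Submodule.subset_span (Or.inr ⟨k, rfl⟩), fun him => hk ?_⟩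
    exact Complex.ext hre him
  · exact ⟨reHat K k, Submodule.subset_span (Or.inl ⟨k, rfl⟩), hre⟩

/-- Input and output of a corrector share one trunk, so S must remain free to grow: the claim covers
every S beyond some S₀, so that finitely many requirements can be met together. -/
theorem exists_weights_of_mem_functionals {ℓ : C(K, ℝ)} (h : ℓ ∈ functionals K) (τ : ℝ) :
    ∃ S₀ : Finset ℤ, ∀ S, S₀ ⊆ S → ∃ w : Fin (S.card + S.card + 1) → ℝ,
      ∀ u : K, ℓ u = w ⬝ᵥ latentInput S τ (Sobolev.toL2 u.1) := by
  induction h using Submodule.span_induction with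
  | mem ℓ hℓ =>
    rcases hℓ with ⟨k, rfl⟩ | ⟨k, rfl⟩
    · refine ⟨{k}, fun S hS => ⟨Pi.single (Fin.castAdd 1 (Fin.castAdd S.card
        (S.equivFin ⟨k, hS (Finset.mem_singleton_self k)⟩))) 1, fun u => ?_⟩⟩
      rw [single_dotProduct, latentInput, Fin.append_left, Fin.append_left]
      simp [reHat, Sobolev.hat]
    · refine ⟨{k}, fun S hS => ⟨Pi.single (Fin.castAdd 1 (Fin.natAdd S.card
        (S.equivFin ⟨k, hS (Finset.mem_singleton_self k)⟩))) 1, fun u => ?_⟩⟩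
      rw [single_dotProduct, latentInput, Fin.append_left, Fin.append_right]
      simp [imHat, Sobolev.hat]
  | zero => exact ⟨∅, fun S _ => ⟨0, fun u => by simp⟩⟩
  | add ℓ m _ _ hℓ hm =>
    obtain ⟨S₁, h₁⟩ := hℓ
    obtain ⟨S₂, h₂⟩ := hm
    refine ⟨S₁ ∪ S₂, fun S hS => ?_⟩
    obtain ⟨w, hw⟩ := h₁ S (Finset.subset_union_left.trans hS)
    obtain ⟨w', hw'⟩ := h₂ S (Finset.subset_union_right.trans hS)
    exact ⟨w + w', fun u => by rw [ContinuousMap.add_apply, hw, hw', add_dotProduct]⟩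
  | smul c ℓ _ hℓ =>
    obtain ⟨S₀, h₀⟩ := hℓ
    refine ⟨S₀, fun S hS => ?_⟩
    obtain ⟨w, hw⟩ := h₀ S hS
    exact ⟨c • w, fun u => by rw [ContinuousMap.smul_apply, hw, smul_dotProduct]⟩

theorem exists_unitSpan_of_mem_span {σ : C(ℝ, ℝ)} {f : C(K, ℝ)} (h : f ∈ Submodule.span ℝ
      {f | ∃ ℓ ∈ functionals K, ∃ b, f = σ.comp (ℓ + ContinuousMap.const K b)}) (τ : ℝ) :
    ∃ S₀ : Finset ℤ, ∀ S, S₀ ⊆ S → ∃ G ∈ unitSpan σ (S.card + S.card + 1),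
      ∀ u : K, f u = G (latentInput S τ (Sobolev.toL2 u.1)) := by
  induction h using Submodule.span_induction with
  | mem f hf =>
    obtain ⟨ℓ, hℓ, b, rfl⟩ := hf
    obtain ⟨S₀, h₀⟩ := exists_weights_of_mem_functionals hℓ τ
    refine ⟨S₀, fun S hS => ?_⟩
    obtain ⟨w, hw⟩ := h₀ S hS
    exact ⟨_, Submodule.subset_span ⟨(w, b), rfl⟩, fun u => by simp [hw]⟩
  | zero => exact ⟨∅, fun S _ => ⟨0, zero_mem _, fun u => by simp⟩⟩
  | add f g _ _ hf hg =>
    obtain ⟨S₁, h₁⟩ := hf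
    obtain ⟨S₂, h₂⟩ := hg
    refine ⟨S₁ ∪ S₂, fun S hS => ?_⟩
    obtain ⟨F, hF, hF'⟩ := h₁ S (Finset.subset_union_left.trans hS)
    obtain ⟨G, hG, hG'⟩ := h₂ S (Finset.subset_union_right.trans hS)
    exact ⟨F + G, add_mem hF hG, fun u => by simp [hF', hG']⟩
  | smul c f _ hf =>
    obtain ⟨S₀, h₀⟩ := hf
    refine ⟨S₀, fun S hS => ?_⟩
    obtain ⟨G, hG, hG'⟩ := h₀ S hS
    exact ⟨c • G, Submodule.smul_mem _ _ hG, fun u => by simp [hG']⟩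

theorem exists_unitSpan_near (hK : IsCompact K) {σ : C(ℝ, ℝ)}
    (hpoly : ¬ ∃ p : Polynomial ℝ, ∀ x, σ x = p.eval x) (τ : ℝ) (f : C(K, ℝ)) {ε : ℝ}
    (hε : 0 < ε) :
    ∃ S₀ : Finset ℤ, ∀ S, S₀ ⊆ S → ∃ G ∈ unitSpan σ (S.card + S.card + 1),
      ∀ u : K, |f u - G (latentInput S τ (Sobolev.toL2 u.1))| ≤ ε := by
  have : CompactSpace K := isCompact_iff_compactSpace.mp hK
  have hd := dense_span_activation hpoly (functionals K) (fun u v h => functionals_separate h)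
  have hf : f ∈ (Submodule.span ℝ {f | ∃ ℓ ∈ functionals K, ∃ b,
      f = σ.comp (ℓ + ContinuousMap.const K b)}).topologicalClosure := by rw [hd]; trivial
  obtain ⟨g, hg, hfg⟩ := Metric.mem_closure_iff.mp hf ε hε
  obtain ⟨S₀, h₀⟩ := exists_unitSpan_of_mem_span hg τ
  refine ⟨S₀, fun S hS => ?_⟩
  obtain ⟨G, hG, hG'⟩ := h₀ S hS
  refine ⟨G, hG, fun u => ?_⟩
  rw [← hG', ← Real.dist_eq]
  exact (ContinuousMap.dist_apply_le_dist u).trans hfg.le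

/-- **Approximation by neural correctors.** A continuous operator on a compact subset of `H^γ` is
uniformly approximated by neural correctors. -/
theorem exists_corrector_near (hK : IsCompact K) (τ : ℝ) {E : Sobolev γ → L2}
    (hE : ContinuousOn E K) {σ : ℝ → ℝ} (hσ : Continuous σ)
    (hpoly : ¬ ∃ p : Polynomial ℝ, ∀ x, σ x = p.eval x) {ε : ℝ} (hε : 0 < ε) :
    ∃ N : NeuralCorrector, ∀ u ∈ K, ‖E u - N.correction σ τ (Sobolev.toL2 u)‖ ≤ ε := by
  classical
  obtain ⟨S₁, hS₁⟩ := exists_partialSum_near (hK.image_of_continuousOn hE) (half_pos hε)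
  -- Real and imaginary parts each err by ε', hence 2ε' per mode and at most ε/2 over S₁; the
  -- truncation takes the other half. The +1 covers an empty S₁.
  set ε' : ℝ := ε / (4 * (S₁.card + 1)) with hε'
  have hε'pos : 0 < ε' := by positivity
  have hcont : ∀ k, Continuous fun u : K => coeff (E u) k := fun k =>
    (continuous_coeff k).comp hE.domRestrict
  choose Sa ha using fun k => exists_unitSpan_near hK (σ := ⟨σ, hσ⟩) hpoly τ
    ⟨fun u : K => (coeff (E u) k).re, continuous_re.comp (hcont k)⟩ hε'pos
  choose Sb hb using fun k => exists_unitSpan_near hK (σ := ⟨σ, hσ⟩) hpoly τ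
    ⟨fun u : K => (coeff (E u) k).im, continuous_im.comp (hcont k)⟩ hε'pos
  -- The trunk holds the output modes S₁ together with all modes the networks need to read; the
  -- output on the additional modes is set to 0.
  set S : Finset ℤ := S₁ ∪ S₁.biUnion fun k => Sa k ∪ Sb k with hS
  have hSsub : ∀ k ∈ S₁, Sa k ⊆ S ∧ Sb k ⊆ S := fun k hk => by
    have h := (Finset.subset_biUnion_of_mem (fun k => Sa k ∪ Sb k) hk).trans
      (Finset.subset_union_right (s₁ := S₁))
    exact ⟨Finset.subset_union_left.trans h, Finset.subset_union_right.trans h⟩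
  have hA : ∀ k, ∃ G ∈ unitSpan σ (S.card + S.card + 1), (k ∈ S₁ → ∀ u : K,
      |(coeff (E u) k).re - G (latentInput S τ (Sobolev.toL2 u.1))| ≤ ε') ∧ (k ∉ S₁ → G = 0) := by
    intro k
    by_cases hk : k ∈ S₁
    · obtain ⟨G, hG, hG'⟩ := ha k S (hSsub k hk).1
      exact ⟨G, hG, fun _ => hG', fun h => absurd hk h⟩
    · exact ⟨0, zero_mem _, fun h => absurd h hk, fun _ => rfl⟩
  have hB : ∀ k, ∃ G ∈ unitSpan σ (S.card + S.card + 1), (k ∈ S₁ → ∀ u : K,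
      |(coeff (E u) k).im - G (latentInput S τ (Sobolev.toL2 u.1))| ≤ ε') ∧ (k ∉ S₁ → G = 0) := by
    intro k
    by_cases hk : k ∈ S₁
    · obtain ⟨G, hG, hG'⟩ := hb k S (hSsub k hk).2
      exact ⟨G, hG, fun _ => hG', fun h => absurd hk h⟩
    · exact ⟨0, zero_mem _, fun h => absurd h hk, fun _ => rfl⟩
  choose A hA1 hA2 hA3 using hA
  choose B hB1 hB2 hB3 using hB
  obtain ⟨N, hN⟩ := exists_corrector τ S A B hA1 hB1
  refine ⟨N, fun u hu => ?_⟩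
  set x := latentInput S τ (Sobolev.toL2 u)
  have hcorr : N.correction σ τ (Sobolev.toL2 u) = ∑ k ∈ S₁, ((A k x : ℂ) + (B k x : ℂ) * I) •
      (fourierBasis (T := 2 * Real.pi) k : L2) := by
    rw [hN]
    refine (Finset.sum_subset Finset.subset_union_left fun k _ hk => ?_).symm
    rw [hA3 k hk, hB3 k hk]
    simp
  have hsplit : E u - N.correction σ τ (Sobolev.toL2 u) = (E u - partialSum S₁ (E u)) +
      ∑ k ∈ S₁, (coeff (E u) k - ((A k x : ℂ) + (B k x : ℂ) * I)) •
        (fourierBasis (T := 2 * Real.pi) k : L2) := by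
    simp only [hcorr, partialSum, sub_smul, Finset.sum_sub_distrib]
    abel
  have hterm : ∀ k ∈ S₁, ‖(coeff (E u) k - ((A k x : ℂ) + (B k x : ℂ) * I)) •
      (fourierBasis (T := 2 * Real.pi) k : L2)‖ ≤ 2 * ε' := by
    intro k hk
    rw [norm_smul, (fourierBasis (T := 2 * Real.pi)).orthonormal.1 k, mul_one]
    refine (Complex.norm_le_abs_re_add_abs_im _).trans ?_
    have h1 := hA2 k hk ⟨u, hu⟩
    have h2 := hB2 k hk ⟨u, hu⟩
    simp only [sub_re, add_re, ofReal_re, mul_re, I_re, ofReal_im, I_im, sub_im, add_im, mul_im]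
    simp only [mul_zero, mul_one, sub_zero, add_zero, zero_add]
    linarith
  have hsum := norm_sum_le_of_le S₁ hterm
  rw [Finset.sum_const, nsmul_eq_mul] at hsum
  have hε'' : (S₁.card : ℝ) * (2 * ε') ≤ ε / 2 := by
    have : (S₁.card + 1 : ℝ) * (2 * ε') = ε / 2 := by rw [hε']; field_simp; ring
    linarith
  rw [hsplit]
  refine (norm_add_le _ _).trans ?_
  have := hS₁ (E u) ⟨u, hu, rfl⟩
  linarith

end Functionals

end Networks

/-- Approximation by neural correctors with a prescribed relative and a prescribed absolute
error, for an operator without zeros. -/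
theorem exists_corrector_relative {γ : ℝ} {K : Set (Sobolev γ)} (hK : IsCompact K) (τ : ℝ)
    {E : Sobolev γ → L2} (hE : ContinuousOn E K) (hE0 : ∀ u ∈ K, E u ≠ 0) {σ : ℝ → ℝ}
    (hσ : Continuous σ) (hpoly : ¬ ∃ p : Polynomial ℝ, ∀ x, σ x = p.eval x) {ε ε' : ℝ}
    (hε : 0 < ε) (hε' : 0 < ε') :
    ∃ N : NeuralCorrector, ∀ u ∈ K,
      ‖E u - N.correction σ τ (Sobolev.toL2 u)‖ / ‖E u‖ ≤ ε ∧
      ‖E u - N.correction σ τ (Sobolev.toL2 u)‖ ≤ ε' := by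
  obtain ⟨m, hm, hmE⟩ : ∃ m : ℝ, 0 < m ∧ ∀ u ∈ K, m ≤ ‖E u‖ := by
    rcases K.eq_empty_or_nonempty with rfl | hne
    · exact ⟨1, one_pos, by simp⟩
    · obtain ⟨v, hv, hmin⟩ := hK.exists_isMinOn hne hE.norm
      exact ⟨‖E v‖, norm_pos_iff.mpr (hE0 v hv), hmin⟩
  -- An absolute error εm, with m a positive lower bound for ‖E‖ on K, is a relative error at most
  -- ε.
  obtain ⟨N, hN⟩ := exists_corrector_near hK τ hE hσ hpoly (lt_min (mul_pos hε hm) hε')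
  refine ⟨N, fun u hu => ⟨?_, (hN u hu).trans (min_le_right _ _)⟩⟩
  rw [div_le_iff₀ (norm_pos_iff.mpr (hE0 u hu))]
  exact ((hN u hu).trans (min_le_left _ _)).trans (mul_le_mul_of_nonneg_left (hmE u hu) hε.le)

end HINLRI

end

/-! ### The theorem: neural correctors applied to general defects and to the resonance defect. -/

theorem mainTheorem3 (γ : ℝ) (hγ0 : 0 < γ) (hγ1 : γ ≤ 1) :
    -- any defect operator that is continuous on a compact set and does not vanish there
    (∀ K : Set (HINLRI.Sobolev γ), IsCompact K →
      ∀ τ : ℝ, 0 < τ →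
      ∀ E : HINLRI.Sobolev γ → HINLRI.L2, ContinuousOn E K → (∀ u ∈ K, E u ≠ 0) →
      ∀ σ : ℝ → ℝ, (∃ L, LipschitzWith L σ) →
        (¬ ∃ p : Polynomial ℝ, ∀ x, σ x = p.eval x) →
      ∀ ε : ℝ, 0 < ε → ∃ N : HINLRI.NeuralCorrector,
        (∀ u ∈ K, ‖E u - N.correction σ τ u.toL2‖ / ‖E u‖ ≤ ε) ∧
        ∀ C : ℝ, (∀ u ∈ K, ‖E u‖ ≤ C * τ ^ (1 + γ) * Real.log (1 / τ) * ‖u‖ ^ 3) →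
          ∀ u ∈ K, ‖E u - N.correction σ τ u.toL2‖ ≤
            C * ε * τ ^ (1 + γ) * Real.log (1 / τ) * ‖u‖ ^ 3) ∧
    -- the resonance defect of the unfiltered integrator
    (∀ τ₀ : ℝ, 0 < τ₀ → τ₀ < 1 → ∃ C : ℝ, 0 < C ∧
      ∀ tn τ : ℝ, 0 < τ → τ ≤ τ₀ →
        (∀ (u : HINLRI.Sobolev γ) (k : ℤ),
          HasSum (HINLRI.cubicTerm (fun φ₁ φ₂ => (τ : ℂ) * HINLRI.mismatch τ φ₁ φ₂) tn τ u.hat k)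
            (HINLRI.coeff (HINLRI.defect tn τ u) k)) ∧
        Continuous (HINLRI.defect tn τ : HINLRI.Sobolev γ → HINLRI.L2) ∧
        (∀ u : HINLRI.Sobolev γ,
          ‖HINLRI.defect tn τ u‖ ≤ C * τ ^ (1 + γ) * Real.log (1 / τ) * ‖u‖ ^ 3) ∧
        ∀ K : Set (HINLRI.Sobolev γ), IsCompact K →
          ∀ R : ℝ, 0 < R → (∀ u ∈ K, ‖u‖ ≤ R) →
          ∀ σ : ℝ → ℝ, (∃ L, LipschitzWith L σ) →
            (¬ ∃ p : Polynomial ℝ, ∀ x, σ x = p.eval x) →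
          ∀ ε : ℝ, 0 < ε → ∃ N : HINLRI.NeuralCorrector,
            ((∀ u ∈ K, HINLRI.defect tn τ u ≠ 0) →
              ∀ u ∈ K, ‖HINLRI.defect tn τ u - N.correction σ τ u.toL2‖ /
                ‖HINLRI.defect tn τ u‖ ≤ ε) ∧
            ∀ u ∈ K, ‖HINLRI.defect tn τ u - N.correction σ τ u.toL2‖ ≤
              C * R ^ 3 * ε * τ ^ (1 + γ) * Real.log (1 / τ)) := by
  refine ⟨?_, ?_⟩
  · intro K hK τ hτ E hE hE0 σ ⟨L, hσ⟩ hpoly ε hε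
    obtain ⟨N, hN⟩ := HINLRI.exists_corrector_relative hK τ hE hE0 hσ.continuous hpoly hε one_pos
    refine ⟨N, fun u hu => (hN u hu).1, fun C hC u hu => ?_⟩
    have h1 := (hN u hu).1
    rw [div_le_iff₀ (norm_pos_iff.mpr (hE0 u hu))] at h1
    calc _ ≤ ε * ‖E u‖ := h1
      _ ≤ ε * (C * τ ^ (1 + γ) * Real.log (1 / τ) * ‖u‖ ^ 3) :=
        mul_le_mul_of_nonneg_left (hC u hu) hε.le
      _ = _ := by ring
  · intro τ₀ hτ₀ hτ₁
    have hC := HINLRI.defectConst_pos hγ0 hτ₀ hτ₁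
    refine ⟨HINLRI.defectConst γ τ₀, hC, fun tn τ hτ hττ₀ => ?_⟩
    obtain ⟨M, hM0, hM, hB, heq⟩ :=
      HINLRI.exists_cubicBound_defect hγ0 hγ1 hτ₁ hτ hττ₀ tn
    have hfun : (HINLRI.defect tn τ : HINLRI.Sobolev γ → HINLRI.L2) =
        HINLRI.cubicOp (fun x y => (τ : ℂ) * HINLRI.mismatch τ x y) tn τ := funext heq
    have hcont : Continuous (HINLRI.defect tn τ : HINLRI.Sobolev γ → HINLRI.L2) := by
      rw [hfun]; exact hB.continuous hM0
    refine ⟨fun u k => ?_, hcont, fun u => ?_, ?_⟩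
    · rw [heq]; exact hB.hasSum u k
    · rw [heq]
      exact (hB.norm_le hM0 u).trans (mul_le_mul_of_nonneg_right hM (by positivity))
    · intro K hK R hR _ σ ⟨L, hσ⟩ hpoly ε hε
      have hlog : 0 < Real.log (1 / τ) :=
        Real.log_pos ((one_lt_div hτ).mpr (hττ₀.trans_lt hτ₁))
      have hτγ := Real.rpow_pos_of_pos hτ (1 + γ)
      have hpos : 0 < HINLRI.defectConst γ τ₀ * R ^ 3 * ε * τ ^ (1 + γ) * Real.log (1 / τ) := by
        positivity
      -- The right-hand side of the error bound is a positive number independent of u, so it can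
      -- serve directly as the target accuracy; zeros of the defect affect only the relative bound.
      by_cases h0 : ∀ u ∈ K, HINLRI.defect tn τ u ≠ 0
      · obtain ⟨N, hN⟩ := HINLRI.exists_corrector_relative hK τ hcont.continuousOn h0
          hσ.continuous hpoly hε hpos
        exact ⟨N, fun _ u hu => (hN u hu).1, fun u hu => (hN u hu).2⟩
      · obtain ⟨N, hN⟩ := HINLRI.exists_corrector_near hK τ hcont.continuousOn hσ.continuous
          hpoly hpos
        exact ⟨N, fun h => absurd h h0, hN⟩
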